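/- Let $V$ be a right quaternionic Hilbert space, equipped with the left scalar multiplication $qf=\sum_k f_k\,q\,\langle f_k,f\rangle$ induced by a Hilbert basis $(f_k)$, and let $T$ be a bounded right $\mathbb H$-linear operator on $V$. For $q\in\mathbb H$ put $Q_q(T)=T^2-2\,\mathrm{Re}(q)\,T+|q|^2\,\mathbb I$, let $\rho_S(T)$ be the set of all $q$ for which $Q_q(T)$ is bijective with bounded inverse, and let $\sigma_S(T)=\mathbb H\setminus\rho_S(T)$. Let $\mathbb S$ be the set of imaginary units of $\mathbb H$, and $[q]=\{\mathrm{Re}(q)+I\,|\mathrm{Im}(q)|: I\in\mathbb S\}$; a set $U\subset\mathbb H$ is axially symmetric if $[q]\subset U$ for every $q\in U$. A set $\sigma\subset\sigma_S(T)$ is an isolated part of $\sigma_S(T)$ if $\sigma$ and $\sigma_S(T)\setminus\sigma$ are both closed in $\sigma_S(T)$. For an axially symmetric isolated part $\sigma$, the Riesz projection is $$P_\sigma=\frac1{2\pi}\int_{\partial(U\cap\mathbb C_I)}S_L^{-1}(q,T)\,dq_I,\qquad S_L^{-1}(q,T)=-Q_q(T)^{-1}(T-\overline q\,\mathbb I),\quad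 dq_I=-dq\,I,$$ where $I\in\mathbb S$, $\mathbb C_I=\mathbb R+I\mathbb R$, and $U$ is any bounded axially symmetric open set with $U\cap\sigma_S(T)=\sigma$ such that $\partial(U\cap\mathbb C_I)$ (the boundary in the plane $\mathbb C_I$) is a finite union of continuously differentiable Jordan curves contained in $\rho_S(T)$, positively oriented: their total winding number is $1$ about each point of $U\cap\mathbb C_I$ and $0$ about each point of $\mathbb C_I$ outside its closure. A point $q\in\sigma_S(T)$ is a right eigenvalue of finite type if $V=V_1\oplus V_2$ with closed $T$-invariant right subspaces $V_1,V_2$ such that $\dim V_1<\infty$, $\sigma_S(T|_{V_1})\cap\sigma_S(T|_{V_2})=\emptyset$ and $\sigma_S(T|_{V_1})=[q]$. Theorem. Let $\sigma$ be an axially symmetric isolated part of $\sigma_S(T)$, let $P_\sigma$ be its Riesz projection, computed with any $U$ and $I$ as above, and let $E_T^\sigma=\{[q]:q\in\sigma\}$ be the set of spheres contained in $\sigma$. Then $\dim R(P_\sigma)<\infty$ if and only if $E_T^\sigma$ is finite and every $q\in\sigma$ is a right eigenvalue of finite type. In that case each $[q]\in E_T^\sigma$ is an isolated part of $\sigma_S(T)$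 for which a set $U$ as above exists, and, for any choice of such sets in the definition of the projections $P_{[q]}$, $$\dim R(P_\sigma)=\sum_{[q]\in E_T^\sigma}\dim R(P_{[q]}).$$ -/

import Mathlib

open scoped Quaternion MulOpposite Topology

noncomputable section

set_option linter.unusedSectionVars false

namespace SpectralQuaternion

/-- A right quaternionic inner product on `V`. A right `ℍ`-vector space is a module over `ℍᵐᵒᵖ`:
the vector usually written `f q` is `MulOpposite.op q • f`. The norm of `V` is the one defined by
the inner product (so that positivity and definiteness hold). A right quaternionic Hilbert space
is such a space that is complete. -/
class QInnerProductSpace (V : Type*) [NormedAddCommGroup V] [Module ℍ[ℝ]ᵐᵒᵖ V] where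
  /-- the inner product, right linear in the second variable -/
  qinner : V → V → ℍ[ℝ]
  qinner_add_right : ∀ f g h : V, qinner f (g + h) = qinner f g + qinner f h
  qinner_smul_right : ∀ (f g : V) (q : ℍ[ℝ]),
    qinner f (MulOpposite.op q • g) = qinner f g * q
  star_qinner : ∀ f g : V, star (qinner g f) = qinner f g
  qinner_self : ∀ f : V, qinner f f = ((‖f‖ ^ 2 : ℝ) : ℍ[ℝ])

open QInnerProductSpace

section InnerProduct

variable {V : Type*} [NormedAddCommGroup V] [NormedSpace ℝ V] [Module ℍ[ℝ]ᵐᵒᵖ V]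
  [IsScalarTower ℝ ℍ[ℝ]ᵐᵒᵖ V] [QInnerProductSpace V]

theorem qinner_add_left (f g h : V) : qinner (f + g) h = qinner f h + qinner g h := by
  rw [← star_qinner, qinner_add_right, star_add, star_qinner, star_qinner]

theorem qinner_smul_left (f g : V) (q : ℍ[ℝ]) :
    qinner (MulOpposite.op q • f) g = star q * qinner f g := by
  rw [← star_qinner, qinner_smul_right, star_mul, star_qinner]

theorem real_smul_eq (r : ℝ) (f : V) : r • f = MulOpposite.op (r : ℍ[ℝ]) • f := by
  have h : MulOpposite.op (r : ℍ[ℝ]) = r • (1 : ℍ[ℝ]ᵐᵒᵖ) := by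
    rw [← MulOpposite.op_one, ← MulOpposite.op_smul]
    congr 1
    ext <;> simp
  rw [h, smul_assoc, one_smul]

theorem norm_op_smul (q : ℍ[ℝ]) (f : V) : ‖MulOpposite.op q • f‖ = ‖q‖ * ‖f‖ := by
  have h := qinner_self (MulOpposite.op q • f)
  rw [qinner_smul_right, qinner_smul_left, qinner_self, mul_assoc,
    (Quaternion.coe_commutes (‖f‖ ^ 2) q), ← mul_assoc, Quaternion.star_mul_self,
    ← Quaternion.coe_mul, Quaternion.coe_inj, Quaternion.normSq_eq_norm_mul_self] at h
  have h2 : ‖MulOpposite.op q • f‖ ^ 2 = (‖q‖ * ‖f‖) ^ 2 := by rw [← h]; ring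
  exact (pow_left_inj₀ (norm_nonneg _) (by positivity) two_ne_zero).1 h2

/-- The real inner product `Re ⟨f, g⟩`. -/
abbrev realInnerProductSpace (V : Type*) [NormedAddCommGroup V] [iR : NormedSpace ℝ V]
    [Module ℍ[ℝ]ᵐᵒᵖ V] [IsScalarTower ℝ ℍ[ℝ]ᵐᵒᵖ V] [QInnerProductSpace V] :
    InnerProductSpace ℝ V :=
  { iR with
    inner := fun f g => (qinner f g).re
    norm_sq_eq_re_inner := fun f => by
      change ‖f‖ ^ 2 = (qinner f f).re
      rw [qinner_self, Quaternion.re_coe]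
    conj_inner_symm := fun f g => by
      change (qinner g f).re = (qinner f g).re
      rw [← star_qinner g f, Quaternion.re_star]
    add_left := fun f g h => by rw [qinner_add_left, Quaternion.re_add]
    smul_left := fun f g r => by
      rw [real_smul_eq, qinner_smul_left]
      simp }

/-- Right multiplication `f ↦ f q`, as a bounded real linear operator. -/
def rightMul (V : Type*) [NormedAddCommGroup V] [NormedSpace ℝ V]
    [Module ℍ[ℝ]ᵐᵒᵖ V] [IsScalarTower ℝ ℍ[ℝ]ᵐᵒᵖ V] [QInnerProductSpace V] (q : ℍ[ℝ]) :
    V →L[ℝ] V :=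
  LinearMap.mkContinuous
    { toFun := fun f => MulOpposite.op q • f
      map_add' := fun f g => smul_add _ f g
      map_smul' := fun r f => smul_comm _ r f }
    ‖q‖ (fun f => (norm_op_smul q f).le)

@[simp] theorem rightMul_apply (q : ℍ[ℝ]) (f : V) : rightMul V q f = MulOpposite.op q • f := rfl

/-- A Hilbert basis: an orthonormal family whose right linear span is dense. -/
structure QHilbertBasis (ι : Type*) (V : Type*) [NormedAddCommGroup V] [Module ℍ[ℝ]ᵐᵒᵖ V]
    [QInnerProductSpace V] where
  vec : ι → V
  qinner_eq_zero : ∀ k l : ι, k ≠ l → qinner (vec k) (vec l) = 0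
  norm_eq_one : ∀ k : ι, ‖vec k‖ = 1
  dense_span : Dense (Submodule.span ℍ[ℝ]ᵐᵒᵖ (Set.range vec) : Set V)

variable {ι : Type*} (F : QHilbertBasis ι V)

theorem norm_sum_sq (s : Finset ι) (a : ι → ℍ[ℝ]) :
    ‖∑ k ∈ s, MulOpposite.op (a k) • F.vec k‖ ^ 2 = ∑ k ∈ s, ‖a k‖ ^ 2 := by
  classical
  let _ := realInnerProductSpace V
  induction s using Finset.induction_on with
  | empty => simp
  | insert k s hk ih =>
    rw [Finset.sum_insert hk, Finset.sum_insert hk, ← ih,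
      ← real_inner_self_eq_norm_sq, real_inner_add_add_self, real_inner_self_eq_norm_sq,
      real_inner_self_eq_norm_sq, norm_op_smul, F.norm_eq_one, inner_sum]
    have : ∑ l ∈ s, inner ℝ (MulOpposite.op (a k) • F.vec k) (MulOpposite.op (a l) • F.vec l)
        = 0 := by
      refine Finset.sum_eq_zero fun l hl => ?_
      change (qinner _ _).re = 0
      rw [qinner_smul_right, qinner_smul_left, F.qinner_eq_zero k l (fun h => hk (h ▸ hl))]
      simp
    rw [this]
    ring

theorem bessel (s : Finset ι) (f : V) :
    ∑ k ∈ s, ‖qinner (F.vec k) f‖ ^ 2 ≤ ‖f‖ ^ 2 := by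
  let _ := realInnerProductSpace V
  set g : V := ∑ k ∈ s, MulOpposite.op (qinner (F.vec k) f) • F.vec k with hg
  have h1 : ‖g‖ ^ 2 = ∑ k ∈ s, ‖qinner (F.vec k) f‖ ^ 2 :=
    norm_sum_sq F s fun k => qinner (F.vec k) f
  have h2 : inner ℝ g f = ∑ k ∈ s, ‖qinner (F.vec k) f‖ ^ 2 := by
    rw [hg, sum_inner]
    refine Finset.sum_congr rfl fun k _ => ?_
    change (qinner _ _).re = _
    rw [qinner_smul_left, Quaternion.star_mul_self, Quaternion.re_coe,
      Quaternion.normSq_eq_norm_mul_self, sq]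
  have h3 : 0 ≤ ‖g - f‖ ^ 2 := by positivity
  rw [norm_sub_sq_real, h2, h1] at h3
  linarith

theorem norm_sum_leftMul_le (s : Finset ι) (q : ℍ[ℝ]) (f : V) :
    ‖∑ k ∈ s, MulOpposite.op (q * qinner (F.vec k) f) • F.vec k‖ ≤ ‖q‖ * ‖f‖ := by
  refine (sq_le_sq₀ (norm_nonneg _) (by positivity)).1 ?_
  rw [norm_sum_sq F s fun k => q * qinner (F.vec k) f, mul_pow]
  simp only [norm_mul, mul_pow]
  rw [← Finset.mul_sum]
  exact mul_le_mul_of_nonneg_left (bessel F s f) (by positivity)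

variable [CompleteSpace V]

theorem summable_leftMul (q : ℍ[ℝ]) (f : V) :
    Summable fun k => MulOpposite.op (q * qinner (F.vec k) f) • F.vec k := by
  have hs : Summable fun k => ‖q * qinner (F.vec k) f‖ ^ 2 := by
    refine summable_of_sum_le (c := ‖q‖ ^ 2 * ‖f‖ ^ 2) (fun k => by positivity) fun s => ?_
    simp only [norm_mul, mul_pow]
    rw [← Finset.mul_sum]
    exact mul_le_mul_of_nonneg_left (bessel F s f) (by positivity)
  rw [summable_iff_vanishing_norm] at hs ⊢
  intro ε hε
  obtain ⟨s, hs⟩ := hs (ε ^ 2) (by positivity)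
  refine ⟨s, fun t ht => ?_⟩
  have h := hs t ht
  rw [← norm_sum_sq F t fun k => q * qinner (F.vec k) f, Real.norm_eq_abs,
    abs_of_nonneg (by positivity)] at h
  exact (sq_lt_sq₀ (norm_nonneg _) hε.le).1 h

/-- The left scalar multiplication `q f = ∑ₖ fₖ q ⟨fₖ, f⟩` induced by a Hilbert basis `(fₖ)`,
as a bounded right linear operator `f ↦ q f`. -/
def leftMul (q : ℍ[ℝ]) : V →L[ℍ[ℝ]ᵐᵒᵖ] V where
  toFun f := ∑' k, MulOpposite.op (q * qinner (F.vec k) f) • F.vec k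
  map_add' f g := by
    rw [← (summable_leftMul F q f).tsum_add (summable_leftMul F q g)]
    simp only [qinner_add_right, mul_add, MulOpposite.op_add, add_smul]
  map_smul' p f := by
    induction p using MulOpposite.rec' with
    | h p =>
      have h := (rightMul V p).map_tsum (summable_leftMul F q f)
      simp only [rightMul_apply] at h
      simp only [RingHom.id_apply]
      rw [h]
      simp only [qinner_smul_right, ← mul_assoc, MulOpposite.op_mul, mul_smul]
  cont := by
    have h : ∀ f : V, ‖∑' k, MulOpposite.op (q * qinner (F.vec k) f) • F.vec k‖ ≤ ‖q‖ * ‖f‖ :=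
      fun f => le_of_tendsto (summable_leftMul F q f).hasSum.norm
        (Filter.Eventually.of_forall fun s => norm_sum_leftMul_le F s q f)
    have hsub : ∀ f g : V, (∑' k, MulOpposite.op (q * qinner (F.vec k) f) • F.vec k)
        - (∑' k, MulOpposite.op (q * qinner (F.vec k) g) • F.vec k)
        = ∑' k, MulOpposite.op (q * qinner (F.vec k) (f - g)) • F.vec k := by
      intro f g
      rw [sub_eq_iff_eq_add, ← (summable_leftMul F q (f - g)).tsum_add (summable_leftMul F q g)]
      refine tsum_congr fun k => ?_
      rw [← add_smul, ← MulOpposite.op_add, ← mul_add, ← qinner_add_right, sub_add_cancel]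
    refine (LipschitzWith.of_dist_le_mul (K := ‖q‖₊) fun f g => ?_).continuous
    rw [dist_eq_norm, dist_eq_norm, hsub]
    exact h _

end InnerProduct

section Spectrum

/-- The set of imaginary unit quaternions. -/
def imUnits : Set ℍ[ℝ] := {J | J.re = 0 ∧ ‖J‖ = 1}

/-- The sphere `[q] = {Re q + J |Im q| : J an imaginary unit}`. -/
def sphere (q : ℍ[ℝ]) : Set ℍ[ℝ] :=
  {p | ∃ J ∈ imUnits, p = (q.re : ℍ[ℝ]) + J * ((‖q.im‖ : ℝ) : ℍ[ℝ])}

/-- Axially symmetric sets of quaternions. -/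
def AxiallySymmetric (U : Set ℍ[ℝ]) : Prop := ∀ q ∈ U, sphere q ⊆ U

/-- The set of equivalence classes of `σ` for `p ∼ q ↔ p ∈ [q]`: the spheres of the elements of
`σ`. -/
def spheresOf (σ : Set ℍ[ℝ]) : Set (Set ℍ[ℝ]) := sphere '' σ

/-- The embedding `x + i y ↦ x + J y` of the complex plane onto the slice `ℝ + J ℝ`. -/
def slice (J : ℍ[ℝ]) (z : ℂ) : ℍ[ℝ] := (z.re : ℍ[ℝ]) + J * (z.im : ℍ[ℝ])

variable {V : Type*} [NormedAddCommGroup V] [NormedSpace ℝ V] [Module ℍ[ℝ]ᵐᵒᵖ V]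
  [IsScalarTower ℝ ℍ[ℝ]ᵐᵒᵖ V]

/-- `Q_q(T) = T² - 2 Re(q) T + |q|²`. -/
def pencil (T : V →L[ℍ[ℝ]ᵐᵒᵖ] V) (q : ℍ[ℝ]) : V →L[ℍ[ℝ]ᵐᵒᵖ] V :=
  T ^ 2 - (2 * q.re) • T + (‖q‖ ^ 2) • (1 : V →L[ℍ[ℝ]ᵐᵒᵖ] V)

/-- The `S`-resolvent set: `Q_q(T)` is bijective with bounded inverse. -/
def sResolventSet (T : V →L[ℍ[ℝ]ᵐᵒᵖ] V) : Set ℍ[ℝ] := {q | IsUnit (pencil T q)}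

/-- The `S`-spectrum. -/
def sSpectrum (T : V →L[ℍ[ℝ]ᵐᵒᵖ] V) : Set ℍ[ℝ] := (sResolventSet T)ᶜ

/-- `σ` is an isolated part of the `S`-spectrum: `σ` and its complement in the spectrum are closed
subsets of the spectrum. -/
structure IsIsolatedPart (T : V →L[ℍ[ℝ]ᵐᵒᵖ] V) (σ : Set ℍ[ℝ]) : Prop where
  subset : σ ⊆ sSpectrum T
  isClosed : IsClosed ((↑) ⁻¹' σ : Set (sSpectrum T))
  isClosed_diff : IsClosed ((↑) ⁻¹' (sSpectrum T \ σ) : Set (sSpectrum T))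

/-- `q ∈ σ_S(T)` is a right eigenvalue of finite type: `V` is the direct sum of two closed
`T`-invariant subspaces `V₁` and `V₂`, where `V₁` is finite dimensional, the `S`-spectra of the
restrictions of `T` to `V₁` and `V₂` are disjoint, and the first one is `[q]`. -/
def IsEigenvalueOfFiniteType (T : V →L[ℍ[ℝ]ᵐᵒᵖ] V) (q : ℍ[ℝ]) : Prop :=
  q ∈ sSpectrum T ∧
  ∃ (V₁ V₂ : Submodule ℍ[ℝ]ᵐᵒᵖ V) (h₁ : ∀ f ∈ V₁, T f ∈ V₁) (h₂ : ∀ f ∈ V₂, T f ∈ V₂),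
    IsClosed (V₁ : Set V) ∧ IsClosed (V₂ : Set V) ∧ IsCompl V₁ V₂ ∧
    FiniteDimensional ℍ[ℝ]ᵐᵒᵖ V₁ ∧
    Disjoint (sSpectrum (T.restrict h₁)) (sSpectrum (T.restrict h₂)) ∧
    sSpectrum (T.restrict h₁) = sphere q

/-- A contour that defines the Riesz projection of `T` for `σ`: an axially symmetric open set `U`
that contains `σ` and no other point of the `S`-spectrum, an imaginary unit `J`, and finitely many
continuously differentiable Jordan curves in the slice `ℝ + J ℝ`, which is identified with `ℂ`,
whose union is the boundary of the slice of `U`, which lie in the `S`-resolvent set, and which are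
positively oriented: together they wind once around each point of the slice of `U`, and zero times
around each point outside its closure. -/
structure RieszContour (T : V →L[ℍ[ℝ]ᵐᵒᵖ] V) (σ : Set ℍ[ℝ]) where
  U : Set ℍ[ℝ]
  isOpen_U : IsOpen U
  isBounded_U : Bornology.IsBounded U
  axiallySymmetric_U : AxiallySymmetric U
  inter_U : U ∩ sSpectrum T = σ
  J : ℍ[ℝ]
  J_mem : J ∈ imUnits
  n : ℕ
  γ : Fin n → ℝ → ℂ
  contDiffOn_γ : ∀ j, ContDiffOn ℝ 1 (γ j) (Set.Icc 0 1)
  closed_γ : ∀ j, γ j 0 = γ j 1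
  injOn_γ : ∀ j, Set.InjOn (γ j) (Set.Ico 0 1)
  frontier_eq : frontier (slice J ⁻¹' U) = ⋃ j, γ j '' Set.Icc 0 1
  mem_resolvent : ∀ j, ∀ t ∈ Set.Icc (0 : ℝ) 1, slice J (γ j t) ∈ sResolventSet T
  winding_eq_one : ∀ z ∈ slice J ⁻¹' U,
    (2 * Real.pi * Complex.I : ℂ)⁻¹ *
      ∑ j, ∫ t in (0 : ℝ)..1, deriv (γ j) t / (γ j t - z) = 1
  winding_eq_zero : ∀ z ∉ closure (slice J ⁻¹' U),
    (2 * Real.pi * Complex.I : ℂ)⁻¹ *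
      ∑ j, ∫ t in (0 : ℝ)..1, deriv (γ j) t / (γ j t - z) = 0

variable [QInnerProductSpace V] [CompleteSpace V] {ι : Type*} (F : QHilbertBasis ι V)

/-- The left `S`-resolvent operator `S_L⁻¹(q, T) = -Q_q(T)⁻¹ (T - q̄)`. Here `q̄` acts by the left
scalar multiplication, and the inverse is the one of the ring of bounded right linear operators. -/
def sResolventLeft (T : V →L[ℍ[ℝ]ᵐᵒᵖ] V) (q : ℍ[ℝ]) : V →L[ℍ[ℝ]ᵐᵒᵖ] V :=
  -(Ring.inverse (pencil T q) * (T - leftMul F (star q)))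

/-- The integrand of `∫ S_L⁻¹(q, T) dq_J` along the curve `c` in the slice `ℝ + J ℝ`, where
`dq_J = - dq J`, as a bounded real linear operator. -/
def rieszIntegrand (T : V →L[ℍ[ℝ]ᵐᵒᵖ] V) (J : ℍ[ℝ]) (c : ℝ → ℂ) (t : ℝ) : V →L[ℝ] V :=
  (sResolventLeft F T (slice J (c t)) * leftMul F (-(slice J (deriv c t)) * J)).restrictScalars ℝ

/-- The integral `(2π)⁻¹ ∫ S_L⁻¹(q, T) dq_J` over the contour, a Bochner integral in the Banach
space of bounded real linear operators. -/
def rieszIntegral (T : V →L[ℍ[ℝ]ᵐᵒᵖ] V) {σ : Set ℍ[ℝ]} (C : RieszContour T σ) : V →L[ℝ] V :=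
  (2 * Real.pi)⁻¹ • ∑ j, ∫ t in (0 : ℝ)..1, rieszIntegrand F T C.J (C.γ j) t

theorem integral_comp_rightMul (A : ℝ → V →L[ℍ[ℝ]ᵐᵒᵖ] V) (q : ℍ[ℝ]) (f : V) :
    (∫ t in (0 : ℝ)..1, (A t).restrictScalars ℝ) (MulOpposite.op q • f)
      = MulOpposite.op q • (∫ t in (0 : ℝ)..1, (A t).restrictScalars ℝ) f := by
  by_cases h : IntervalIntegrable (fun t => (A t).restrictScalars ℝ) MeasureTheory.volume 0 1
  · have h2 : IntervalIntegrable (fun t => A t f) MeasureTheory.volume 0 1 := by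
      have := h
      rw [intervalIntegrable_iff] at this ⊢
      exact (ContinuousLinearMap.apply ℝ V f).integrable_comp this
    rw [ContinuousLinearMap.intervalIntegral_apply h, ContinuousLinearMap.intervalIntegral_apply h]
    have h3 := (rightMul V q).intervalIntegral_comp_comm h2
    simpa using h3
  · rw [intervalIntegral.integral_undef h]
    simp

/-- The quaternionic Riesz projection `P_σ = (2π)⁻¹ ∫ S_L⁻¹(q, T) dq_J`, the integral being taken
over a contour for `σ`, as a bounded right linear operator. -/
def rieszProjection (T : V →L[ℍ[ℝ]ᵐᵒᵖ] V) {σ : Set ℍ[ℝ]} (C : RieszContour T σ) :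
    V →L[ℍ[ℝ]ᵐᵒᵖ] V where
  toFun := rieszIntegral F T C
  map_add' := map_add _
  map_smul' p f := by
    induction p using MulOpposite.rec' with
    | h p =>
      have h : ∀ g : V, rieszIntegral F T C g = (2 * Real.pi)⁻¹ •
          ∑ j, (∫ t in (0 : ℝ)..1, rieszIntegrand F T C.J (C.γ j) t) g := by
        intro g
        simp [rieszIntegral]
      simp only [RingHom.id_apply]
      have h2 : ∑ j, (∫ t in (0 : ℝ)..1, rieszIntegrand F T C.J (C.γ j) t) (MulOpposite.op p • f)
          = MulOpposite.op p • ∑ j, (∫ t in (0 : ℝ)..1, rieszIntegrand F T C.J (C.γ j) t) f := by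
        rw [Finset.smul_sum]
        exact Finset.sum_congr rfl fun j _ => integral_comp_rightMul _ p f
      rw [h, h, h2, smul_comm]
  cont := (rieszIntegral F T C).cont

end Spectrum

end SpectralQuaternion

end

open SpectralQuaternion

/-! Everything is reduced to complex spectral theory. Right multiplication by complex numbers makes
`V` a complex Banach space, and `v ↦ v j` is an antilinear map on it; the right quaternionic
operators are exactly the complex linear ones that commute with this map. On the complex space the
pencil factors as `(z - T)(z̄ - T)` (`lift_pencil`), so the slice of the S-resolvent set is the
complex resolvent set (`isUnit_pencil_iff`).

The quaternionic Riesz projection then equals the complex Riesz integral over the same curves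
(`lift_rieszProjection`). The two integrals have the same components `X` and `Y`, combined as `X + Y
J` with left multiplication by `J` and as `X + i Y`; the complex integral commutes with `j`, which
forces `Y = 0`.

No contour is ever deformed. The Cauchy transform `h` of the resolvent satisfies `h(z) (z - a) =
wind(z) - E`, so `z - a` is invertible on the range of `1 - E` for `z` in `U` and on the range of
`E` for `z` outside `U`. Liouville's theorem gives `E² = E`, and also the principle
`InvertibleOn.mul_eq_zero`: if, for every `z`, `z - a` is invertible on the range of one of two
commuting idempotents `e`, `f` that commute with `a`, then `e f = 0`. All comparisons of projections
come from this principle: invariance under `j`, orthogonality for disjoint parts, and domination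
(`mul_eq_self`).

If `P_σ` has finite rank, then `T` has finitely many spectral values on its range, so `σ` consists
of finitely many spheres. Each sphere is isolated and surrounded by discs; `P_[q]` is dominated by
`P_σ`, and its range and kernel give the required decomposition. Conversely, the projection of any
finite type decomposition dominates `P_[q]`, and `P_σ` is the sum of the `P_[q]`
(`rieszProjection_eq_sum`). Orthogonality of the summands gives the dimension formula. -/

open scoped Quaternion MulOpposite Topology
set_option linter.unusedSectionVars false

/-! ### Invertibility on the range of an idempotent, in a ring -/

section InvertibleOn

/-- `a` is invertible on the range of the idempotent `e`. -/
def InvertibleOn {A : Type*} [Ring A] (a e : A) : Prop := ∃ h, h * a = e ∧ a * h = e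

namespace InvertibleOn

variable {A : Type*} [Ring A] {a b e f : A}

theorem mul_left (h : InvertibleOn a e) (hf : Commute a f) : InvertibleOn a (f * e) := by
  obtain ⟨g, h1, h2⟩ := h
  exact ⟨f * g, by rw [mul_assoc, h1], by rw [← mul_assoc, hf.eq, mul_assoc, h2]⟩

theorem add (h : InvertibleOn a e) (h' : InvertibleOn a f) : InvertibleOn a (e + f) := by
  obtain ⟨g, h1, h2⟩ := h
  obtain ⟨g', h1', h2'⟩ := h'
  exact ⟨g + g', by rw [add_mul, h1, h1'], by rw [mul_add, h2, h2']⟩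

theorem isUnit (h : InvertibleOn a e) (h' : InvertibleOn a (1 - e)) : IsUnit a := by
  obtain ⟨g, h1, h2⟩ := h.add h'
  rw [add_sub_cancel] at h1 h2
  exact ⟨⟨a, g, h2, h1⟩, rfl⟩

theorem of_isUnit (h : IsUnit a) (he : Commute a e) : InvertibleOn a e := by
  obtain ⟨u, rfl⟩ := h
  exact ⟨e * ↑u⁻¹, by simp [mul_assoc], by rw [← mul_assoc, he.eq]; simp [mul_assoc]⟩

theorem mul (h : InvertibleOn a e) (h' : InvertibleOn b e) (he : IsIdempotentElem e)
    (ha : Commute a e) (hb : Commute b e) : InvertibleOn (a * b) e := by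
  obtain ⟨g, h1, h2⟩ := h
  obtain ⟨g', h1', h2'⟩ := h'
  refine ⟨g' * g, ?_, ?_⟩
  · rw [mul_assoc, ← mul_assoc g, h1, ← hb.eq, ← mul_assoc, h1', he.eq]
  · rw [mul_assoc, ← mul_assoc b, h2', ← mul_assoc, ha.eq, mul_assoc, h2, he.eq]

/-- If `g` inverts `a b` on `e`, then `g b` is a left inverse of `a` and `b g` a right inverse. They
agree once cut down by `e` (`h4`), so no commutation of `g` with `b` has to be known. This extracts
a linear factor from the pencil. -/
theorem of_mul (h : InvertibleOn (a * b) e) (hab : Commute a b) (he : IsIdempotentElem e)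
    (ha : Commute a e) : InvertibleOn a e := by
  obtain ⟨g, h1, h2⟩ := h
  have h3 : e * g = g * e := by rw [← h1, mul_assoc, h2, ← h1]
  have h4 : g * b * e = e * (b * g) := by
    calc g * b * e = g * (b * a) * (b * g) := by rw [← h2]; simp only [mul_assoc]
      _ = e * (b * g) := by rw [← hab.eq, h1]
  refine ⟨g * b * e, ?_, ?_⟩
  · rw [mul_assoc, ← ha.eq, ← mul_assoc, mul_assoc g, ← hab.eq, h1, he.eq]
  · rw [h4, ← mul_assoc, ha.eq, mul_assoc, ← mul_assoc a, h2, he.eq]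

/-- Normalised inverse. -/
theorem exists_normalized (h : InvertibleOn a e) (he : IsIdempotentElem e) (ha : Commute a e) :
    ∃ g, g * a = e ∧ a * g = e ∧ g * e = g ∧ e * g = g := by
  obtain ⟨g, h1, h2⟩ := h
  have h3 : e * g = g * e := by
    calc e * g = g * a * g := by rw [h1]
      _ = g * e := by rw [mul_assoc, h2]
  refine ⟨g * e, ?_, ?_, ?_, ?_⟩
  · rw [mul_assoc, ← ha.eq, ← mul_assoc, h1, he.eq]
  · rw [← mul_assoc, h2, he.eq]
  · rw [mul_assoc, he.eq]
  · rw [← mul_assoc, h3, mul_assoc, he.eq]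

/-- The usual `g = g (a g') = (g a) g'`. It is what lets an inverse inherit the symmetries of `a`
and `e`. -/
theorem unique {g g' : A} (h1 : g * a = e) (h2 : g * e = g) (h1' : a * g' = e) (h2' : e * g' = g') :
    g = g' := by
  rw [← h2, ← h1', ← mul_assoc, h1, h2']

theorem map {B : Type*} [Ring B] (φ : A →+* B) (h : InvertibleOn a e) :
    InvertibleOn (φ a) (φ e) := by
  obtain ⟨g, h1, h2⟩ := h
  exact ⟨φ g, by rw [← map_mul, h1], by rw [← map_mul, h2]⟩

end InvertibleOn

end InvertibleOn

/-! ### Liouville's theorem for resolvents -/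

section Liouville

open Filter

variable {B : Type*} [NormedRing B] [NormedAlgebra ℂ B] [CompleteSpace B]

/-- An entire function of the form `c (z - a)⁻¹` vanishes. -/
theorem eq_zero_of_entire_mul_resolvent {a c : B} {F : ℂ → B} (hF : Differentiable ℂ F)
    (h : ∀ z, F z * (algebraMap ℂ B z - a) = c) : c = 0 := by
  have hres : Tendsto (fun z => c * resolvent a z) (cocompact ℂ) (𝓝 0) := by
    have h0 : Tendsto (resolvent a : ℂ → B) (cocompact ℂ) (𝓝 0) := by
      simpa [Metric.cobounded_eq_cocompact] using
        spectrum.resolvent_tendsto_cobounded (𝕜 := ℂ) a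
    simpa using h0.const_mul c
  -- Off the compact spectrum `F` is `c` times the resolvent, so it tends to zero at infinity.
  have hev : ∀ᶠ z in cocompact ℂ, c * resolvent a z = F z := by
    have hb : ∀ᶠ z in cocompact ℂ, z ∈ resolventSet ℂ a := by
      have := (spectrum.isCompact (𝕜 := ℂ) a).compl_mem_cocompact
      filter_upwards [this] with z hz
      exact spectrum.notMem_iff.1 hz
    filter_upwards [hb] with z hz
    rw [← h z, mul_assoc, resolvent, Ring.mul_inverse_cancel _ hz, mul_one]
  have h0 : F 0 = 0 := hF.apply_eq_of_tendsto_cocompact 0 (hres.congr' hev)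
  have : ∀ z, F z = 0 := fun z => hF.apply_eq_of_tendsto_cocompact z (hres.congr' hev)
  rw [← h 0, h0, zero_mul]

/-- If `z - a` is invertible on the range of `e` for all `z`, then `e = 0`. -/
theorem eq_zero_of_forall_invertibleOn {a e : B} (he : IsIdempotentElem e) (hae : Commute a e)
    (h : ∀ z : ℂ, InvertibleOn (algebraMap ℂ B z - a) e) : e = 0 := by
  have hc : ∀ z : ℂ, Commute (algebraMap ℂ B z - a) e := fun z =>
    Commute.sub_left (Algebra.commutes z e) hae
  choose F h1 h2 h3 h4 using fun z => (h z).exists_normalized he (hc z)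
  refine eq_zero_of_entire_mul_resolvent (a := a) (F := F) (fun w => ?_) h1
  -- The resolvent identity for the local inverses. For `z` near `w` the second factor is a unit,
  -- which expresses `F z` through the fixed element `F w` and so gives differentiability at `w`.
  have key : ∀ z, F z * (1 - (w - z) • F w) = F w := by
    intro z
    have h5 : algebraMap ℂ B w - a = (algebraMap ℂ B z - a) + algebraMap ℂ B (w - z) := by
      rw [map_sub]; abel
    have h6 : F z = F z * (algebraMap ℂ B w - a) * F w := by rw [mul_assoc, h2, h3]
    have h7 : F z = F w + (w - z) • (F z * F w) := by
      rw [h5, mul_add, h1, add_mul, h4] at h6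
      rw [h6]
      congr 1
      rw [← h6, ← Algebra.commutes, mul_assoc, Algebra.smul_def]
    rw [mul_sub, mul_one, mul_smul_comm, sub_eq_iff_eq_add]
    exact h7
  have hcont : ContinuousAt (fun z : ℂ => 1 - (w - z) • F w) w := by fun_prop
  have hunit : ∀ᶠ z in 𝓝 w, IsUnit (1 - (w - z) • F w) := by
    refine hcont.eventually (Units.isOpen.mem_nhds ?_)
    simp
  have heq : F =ᶠ[𝓝 w] fun z => F w * Ring.inverse (1 - (w - z) • F w) := by
    filter_upwards [hunit] with z hz
    rw [← key z, mul_assoc, key z, Ring.mul_inverse_cancel _ hz, mul_one]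
  have hd : DifferentiableAt ℂ (fun z : ℂ => 1 - (w - z) • F w) w := by fun_prop
  refine DifferentiableAt.congr_of_eventuallyEq ?_ heq
  refine (differentiableAt_const _).mul ?_
  exact DifferentiableAt.fun_comp' (g := Ring.inverse) w (differentiableAt_inverse (by simp)) hd

end Liouville

/-! ### Cauchy transforms along continuously differentiable curves -/

section Contour

open MeasureTheory intervalIntegral

variable {γ : ℝ → ℂ} {E : Type*} [NormedAddCommGroup E] [NormedSpace ℂ E]

/-- Smoothness is only assumed on `[0, 1]`, so `deriv γ` is uncontrolled at the end points. It
agrees with the continuous one-sided derivative on the open interval, hence almost everywhere. -/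
theorem intervalIntegrable_deriv_of_contDiffOn (hγ : ContDiffOn ℝ 1 γ (Set.Icc 0 1)) :
    IntervalIntegrable (deriv γ) volume 0 1 := by
  have h1 : ContinuousOn (derivWithin γ (Set.Icc 0 1)) (Set.Icc 0 1) :=
    hγ.continuousOn_derivWithin (uniqueDiffOn_Icc zero_lt_one) le_rfl
  have h2 : IntervalIntegrable (derivWithin γ (Set.Icc 0 1)) volume 0 1 :=
    ContinuousOn.intervalIntegrable_of_Icc zero_le_one h1
  refine h2.congr_ae ?_
  rw [Set.uIoc_of_le zero_le_one, ← restrict_Ioo_eq_restrict_Ioc]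
  filter_upwards [ae_restrict_mem measurableSet_Ioo] with t ht
  exact derivWithin_of_mem_nhds (Icc_mem_nhds ht.1 ht.2)

theorem intervalIntegrable_deriv_smul (hγ : ContDiffOn ℝ 1 γ (Set.Icc 0 1)) {f : ℝ → E}
    (hf : ContinuousOn f (Set.Icc 0 1)) :
    IntervalIntegrable (fun t => deriv γ t • f t) volume 0 1 :=
  (intervalIntegrable_deriv_of_contDiffOn hγ).smul_continuousOn
    (by rwa [Set.uIcc_of_le zero_le_one])

/-- Differentiation under the integral sign. The point has a ball of radius `ε` free of the compact
curve; on the ball of half the radius the kernel has denominator at least `ε / 2` in norm, whence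
the dominating function. -/
theorem differentiableAt_cauchyTransform [CompleteSpace E]
    (hγ : ContDiffOn ℝ 1 γ (Set.Icc 0 1)) {f : ℝ → E}
    (hf : ContinuousOn f (Set.Icc 0 1)) {z₀ : ℂ} (hz : z₀ ∉ γ '' Set.Icc 0 1) :
    DifferentiableAt ℂ (fun z => ∫ t in (0 : ℝ)..1, deriv γ t • ((γ t - z)⁻¹ • f t)) z₀ := by
  have hc : IsCompact (γ '' Set.Icc (0 : ℝ) 1) := isCompact_Icc.image_of_continuousOn hγ.continuousOn
  obtain ⟨ε, hε, hball⟩ := Metric.isOpen_iff.1 hc.isClosed.isOpen_compl z₀ hz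
  have hdist : ∀ t ∈ Set.Icc (0 : ℝ) 1, ∀ z ∈ Metric.ball z₀ (ε / 2), ε / 2 ≤ ‖γ t - z‖ := by
    intro t ht z hz
    by_contra! hlt
    refine hball (show γ t ∈ Metric.ball z₀ ε from ?_) ⟨t, ht, rfl⟩
    rw [Metric.mem_ball] at hz ⊢
    calc dist (γ t) z₀ ≤ dist (γ t) z + dist z z₀ := dist_triangle _ _ _
      _ < ε / 2 + ε / 2 := add_lt_add (by rwa [dist_eq_norm]) hz
      _ = ε := by ring
  have hne : ∀ t ∈ Set.Icc (0 : ℝ) 1, ∀ z ∈ Metric.ball z₀ (ε / 2), γ t - z ≠ 0 := by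
    intro t ht z hz h0
    have := hdist t ht z hz
    rw [h0, norm_zero] at this
    linarith
  obtain ⟨M, hM⟩ := isCompact_Icc.exists_bound_of_continuousOn hf
  have hint : ∀ z ∈ Metric.ball z₀ (ε / 2),
      IntervalIntegrable (fun t => deriv γ t • ((γ t - z)⁻¹ • f t)) volume 0 1 := fun z hz =>
    intervalIntegrable_deriv_smul hγ
      (((hγ.continuousOn.sub continuousOn_const).inv₀ fun t ht => hne t ht z hz).smul hf)
  have hz0 : z₀ ∈ Metric.ball z₀ (ε / 2) := Metric.mem_ball_self (by positivity)
  have hint' : IntervalIntegrable (fun t => deriv γ t • (((γ t - z₀) ^ 2)⁻¹ • f t)) volume 0 1 :=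
    intervalIntegrable_deriv_smul hγ
      ((((hγ.continuousOn.sub continuousOn_const).pow 2).inv₀
        fun t ht => pow_ne_zero 2 (hne t ht z₀ hz0)).smul hf)
  have hmem : ∀ t ∈ Set.uIoc (0 : ℝ) 1, t ∈ Set.Icc (0 : ℝ) 1 := fun t ht => by
    rw [Set.uIoc_of_le zero_le_one] at ht
    exact Set.Ioc_subset_Icc_self ht
  refine (hasDerivAt_integral_of_dominated_loc_of_deriv_le (μ := volume)
    (F' := fun z t => deriv γ t • (((γ t - z) ^ 2)⁻¹ • f t))
    (bound := fun t => ‖deriv γ t‖ * (((ε / 2) ^ 2)⁻¹ * M))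
    (Metric.ball_mem_nhds z₀ (half_pos hε)) ?_ (hint z₀ hz0) ?_ ?_ ?_ ?_).2.differentiableAt
  · filter_upwards [Metric.ball_mem_nhds z₀ (half_pos hε)] with z hz
    exact (intervalIntegrable_iff.1 (hint z hz)).aestronglyMeasurable
  · exact (intervalIntegrable_iff.1 hint').aestronglyMeasurable
  · refine Filter.Eventually.of_forall fun t ht z hz => ?_
    rw [norm_smul, norm_smul, norm_inv, norm_pow]
    have h1 := hdist t (hmem t ht) z hz
    have h2 := hM t (hmem t ht)
    gcongr
  · exact (intervalIntegrable_deriv_of_contDiffOn hγ).norm.mul_const _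
  · refine Filter.Eventually.of_forall fun t ht z hz => ?_
    have h1 : HasDerivAt (fun z => (γ t - z)⁻¹) (((γ t - z) ^ 2)⁻¹) z := by
      have := ((hasDerivAt_id z).const_sub (γ t)).inv (hne t (hmem t ht) z hz)
      simpa using! this
    exact (h1.smul_const (f t)).const_smul (deriv γ t)

end Contour

/-! ### The complex Riesz projection from a single cycle -/

section RieszIdempotent

open MeasureTheory intervalIntegral

variable {B : Type*} [NormedRing B] [NormedAlgebra ℂ B] {n : ℕ}

/-- The Riesz integral `(2πi)⁻¹ ∑ ∫ (z - a)⁻¹ dz` over a cycle. -/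
noncomputable def resolventIntegral (a : B) (γ : Fin n → ℝ → ℂ) : B :=
  (2 * Real.pi * Complex.I : ℂ)⁻¹ •
    ∑ j, ∫ t in (0 : ℝ)..1, deriv (γ j) t • resolvent a (γ j t)

/-- The Cauchy transform of the resolvent over a cycle. -/
noncomputable def resolventCauchyTransform (a : B) (γ : Fin n → ℝ → ℂ) (z : ℂ) : B :=
  (2 * Real.pi * Complex.I : ℂ)⁻¹ •
    ∑ j, ∫ t in (0 : ℝ)..1, deriv (γ j) t • ((γ j t - z)⁻¹ • resolvent a (γ j t))

/-- A cycle in the resolvent set of `a` that is the oriented boundary of the open set `U`. -/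
structure IsBoundaryCycle (a : B) (U : Set ℂ) (γ : Fin n → ℝ → ℂ) : Prop where
  contDiffOn : ∀ j, ContDiffOn ℝ 1 (γ j) (Set.Icc 0 1)
  mem_resolventSet : ∀ j, ∀ t ∈ Set.Icc (0 : ℝ) 1, γ j t ∈ resolventSet ℂ a
  isOpen : IsOpen U
  frontier_eq : frontier U = ⋃ j, γ j '' Set.Icc 0 1
  winding_eq_one : ∀ z ∈ U, (2 * Real.pi * Complex.I : ℂ)⁻¹ *
    ∑ j, ∫ t in (0 : ℝ)..1, deriv (γ j) t / (γ j t - z) = 1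
  winding_eq_zero : ∀ z ∉ closure U, (2 * Real.pi * Complex.I : ℂ)⁻¹ *
    ∑ j, ∫ t in (0 : ℝ)..1, deriv (γ j) t / (γ j t - z) = 0

theorem Commute.resolvent_right {a b : B} (h : Commute b a) (z : ℂ) :
    Commute b (resolvent a z) := by
  have hc : Commute b (algebraMap ℂ B z - a) :=
    Commute.sub_right (Algebra.commutes z b).symm h
  by_cases hu : IsUnit (algebraMap ℂ B z - a)
  · obtain ⟨u, hu⟩ := hu
    rw [resolvent, ← hu, Ring.inverse_unit]
    exact Commute.units_inv_right (hu ▸ hc)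
  · rw [resolvent, Ring.inverse_non_unit _ hu]
    exact Commute.zero_right b

theorem continuousOn_resolvent_comp [CompleteSpace B] {a : B} {c : ℝ → ℂ} (hc : ContDiffOn ℝ 1 c (Set.Icc 0 1))
    (hmem : ∀ t ∈ Set.Icc (0 : ℝ) 1, c t ∈ resolventSet ℂ a) :
    ContinuousOn (fun t => resolvent a (c t)) (Set.Icc 0 1) := fun t ht =>
  ContinuousAt.comp_continuousWithinAt (f := c) (g := resolvent a)
    (spectrum.hasDerivAt_resolvent_const_left (hmem t ht)).continuousAt (hc.continuousOn t ht)

namespace IsBoundaryCycle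

variable {a : B} {γ : Fin n → ℝ → ℂ} {U : Set ℂ} (C : IsBoundaryCycle a U γ)
include C

theorem notMem_of_mem {z : ℂ} (hz : z ∈ U) : z ∉ ⋃ j, γ j '' Set.Icc 0 1 := by
  rw [← C.frontier_eq, C.isOpen.frontier_eq]
  exact fun h => h.2 hz

theorem notMem_of_notMem_closure {z : ℂ} (hz : z ∉ closure U) :
    z ∉ ⋃ j, γ j '' Set.Icc 0 1 := by
  rw [← C.frontier_eq]
  exact fun h => hz (frontier_subset_closure h)

theorem mem_resolventSet_of_mem_frontier {z : ℂ} (hz : z ∈ frontier U) :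
    z ∈ resolventSet ℂ a := by
  rw [C.frontier_eq] at hz
  obtain ⟨j, t, ht, rfl⟩ := Set.mem_iUnion.1 hz
  exact C.mem_resolventSet j t ht

variable [CompleteSpace B]

theorem intervalIntegrable (j : Fin n) :
    IntervalIntegrable (fun t => deriv (γ j) t • resolvent a (γ j t)) volume 0 1 :=
  intervalIntegrable_deriv_smul (C.contDiffOn j)
    (continuousOn_resolvent_comp (C.contDiffOn j) (C.mem_resolventSet j))

theorem commute_resolventIntegral {b : B} (h : Commute b a) :
    Commute b (resolventIntegral a γ) := by
  refine Commute.smul_right (Commute.sum_right _ _ _ fun j _ => ?_) _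
  have h1 := (ContinuousLinearMap.mul ℂ B b).intervalIntegral_comp_comm (C.intervalIntegrable j)
  have h2 := ((ContinuousLinearMap.mul ℂ B).flip b).intervalIntegral_comp_comm
    (C.intervalIntegrable j)
  simp only [ContinuousLinearMap.mul_apply', ContinuousLinearMap.flip_apply] at h1 h2
  rw [Commute, SemiconjBy, ← h1, ← h2]
  refine integral_congr fun t _ => ?_
  exact (Commute.smul_right (h.resolvent_right _) _).eq

/-- Writing `z - a = (w - a) - (w - z)` at the point `w` of the curve, the first term cancels the
resolvent and leaves the winding number, the second cancels the Cauchy kernel and leaves the Riesz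
integral. -/
theorem resolventCauchyTransform_mul_sub {z : ℂ} (hz : z ∉ ⋃ j, γ j '' Set.Icc 0 1) :
    resolventCauchyTransform a γ z * (algebraMap ℂ B z - a) =
      ((2 * Real.pi * Complex.I : ℂ)⁻¹ *
        ∑ j, ∫ t in (0 : ℝ)..1, deriv (γ j) t / (γ j t - z)) • (1 : B) -
      resolventIntegral a γ := by
  rw [resolventCauchyTransform, resolventIntegral, smul_mul_assoc, mul_smul, ← smul_sub,
    Finset.sum_mul, Finset.sum_smul, ← Finset.sum_sub_distrib]
  congr 1
  refine Finset.sum_congr rfl fun j _ => ?_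
  have hne : ∀ t ∈ Set.Icc (0 : ℝ) 1, γ j t - z ≠ 0 := fun t ht h0 =>
    hz (Set.mem_iUnion.2 ⟨j, t, ht, sub_eq_zero.1 h0⟩)
  have hinv : ContinuousOn (fun t => (γ j t - z)⁻¹) (Set.Icc 0 1) :=
    ((C.contDiffOn j).continuousOn.sub continuousOn_const).inv₀ hne
  have hi2 := intervalIntegrable_deriv_smul (C.contDiffOn j)
    (hinv.smul (continuousOn_resolvent_comp (C.contDiffOn j) (C.mem_resolventSet j)))
  have hi3 := intervalIntegrable_deriv_smul (C.contDiffOn j)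
    (hinv.smul (continuousOn_const (c := (1 : B))))
  have h1 := ((ContinuousLinearMap.mul ℂ B).flip
    (algebraMap ℂ B z - a)).intervalIntegral_comp_comm hi2
  have h2 : ∫ t in (0 : ℝ)..1, (deriv (γ j) t / (γ j t - z)) • (1 : B) =
      (∫ t in (0 : ℝ)..1, deriv (γ j) t / (γ j t - z)) • (1 : B) := integral_smul_const _ _
  simp only [ContinuousLinearMap.mul_apply', ContinuousLinearMap.flip_apply, Pi.smul_apply'] at h1
  rw [← h1, ← h2, ← intervalIntegral.integral_sub]
  · refine integral_congr fun t ht => ?_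
    rw [Set.uIcc_of_le zero_le_one] at ht
    have h3 : algebraMap ℂ B z - a =
        (algebraMap ℂ B (γ j t) - a) - algebraMap ℂ B (γ j t - z) := by
      rw [map_sub]; abel
    have h4 : resolvent a (γ j t) * (algebraMap ℂ B z - a) =
        1 - (γ j t - z) • resolvent a (γ j t) := by
      rw [h3, mul_sub, resolvent, Ring.inverse_mul_cancel _ (C.mem_resolventSet j t ht),
        ← Algebra.commutes, Algebra.smul_def]
    simp only [smul_mul_assoc]
    rw [h4, smul_sub, smul_smul _ _ (resolvent a _), inv_mul_cancel₀ (hne t ht), one_smul,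
      smul_sub, smul_smul, div_eq_mul_inv]
  · simpa only [div_eq_mul_inv, mul_smul] using! hi3
  · exact C.intervalIntegrable j

theorem differentiableAt_resolventCauchyTransform {z : ℂ} (hz : z ∉ ⋃ j, γ j '' Set.Icc 0 1) :
    DifferentiableAt ℂ (resolventCauchyTransform a γ) z := by
  unfold resolventCauchyTransform
  refine DifferentiableAt.fun_const_smul (DifferentiableAt.fun_sum fun j _ => ?_) _
  exact differentiableAt_cauchyTransform (C.contDiffOn j)
    (continuousOn_resolvent_comp (C.contDiffOn j) (C.mem_resolventSet j))
    fun h => hz (Set.mem_iUnion.2 ⟨j, h⟩)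

theorem resolventCauchyTransform_mul_sub_of_mem {z : ℂ} (hz : z ∈ U) :
    resolventCauchyTransform a γ z * (algebraMap ℂ B z - a) = 1 - resolventIntegral a γ := by
  rw [C.resolventCauchyTransform_mul_sub (C.notMem_of_mem hz), C.winding_eq_one z hz, one_smul]

theorem resolventCauchyTransform_mul_sub_of_notMem {z : ℂ} (hz : z ∉ closure U) :
    resolventCauchyTransform a γ z * (algebraMap ℂ B z - a) = -resolventIntegral a γ := by
  rw [C.resolventCauchyTransform_mul_sub (C.notMem_of_notMem_closure hz), C.winding_eq_zero z hz,
    zero_smul, zero_sub]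

theorem commute_resolventCauchyTransform {b : B} (h : Commute b a) (z : ℂ)
    (hz : z ∉ ⋃ j, γ j '' Set.Icc 0 1) :
    Commute b (resolventCauchyTransform a γ z) := by
  refine Commute.smul_right (Commute.sum_right _ _ _ fun j _ => ?_) _
  have hne : ∀ t ∈ Set.Icc (0 : ℝ) 1, γ j t - z ≠ 0 := fun t ht h0 =>
    hz (Set.mem_iUnion.2 ⟨j, t, ht, sub_eq_zero.1 h0⟩)
  have hi := intervalIntegrable_deriv_smul (C.contDiffOn j)
    ((((C.contDiffOn j).continuousOn.sub continuousOn_const).inv₀ hne).smul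
      (continuousOn_resolvent_comp (C.contDiffOn j) (C.mem_resolventSet j)))
  have h1 := (ContinuousLinearMap.mul ℂ B b).intervalIntegral_comp_comm hi
  have h2 := ((ContinuousLinearMap.mul ℂ B).flip b).intervalIntegral_comp_comm hi
  simp only [ContinuousLinearMap.mul_apply', ContinuousLinearMap.flip_apply, Pi.smul_apply',
    Pi.sub_apply, Pi.inv_apply] at h1 h2
  rw [Commute, SemiconjBy, ← h1, ← h2]
  refine integral_congr fun t _ => ?_
  exact (Commute.smul_right (Commute.smul_right (h.resolvent_right _) _) _).eq

/-- The Riesz integral of the resolvent is idempotent. -/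
theorem isIdempotentElem_resolventIntegral : IsIdempotentElem (resolventIntegral a γ) := by
  classical
  set E := resolventIntegral a γ with hE
  set h := resolventCauchyTransform a γ with hh
  -- An entire extension of `E (1 - E) (z - a)⁻¹`: inside `U`, `h z (z - a) = 1 - E`; outside the
  -- closure it is `-E`; on the boundary the resolvent itself exists.
  let F : ℂ → B := fun z =>
    if z ∈ U then E * h z else if z ∈ closure U then E * (1 - E) * resolvent a z
    else -((1 - E) * h z)
  have hFU : ∀ z ∈ U, F z = E * h z := fun z hz => if_pos hz
  have hFe : ∀ z ∉ closure U, F z = -((1 - E) * h z) := fun z hz => by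
    simp only [F, if_neg hz, if_neg fun h' => hz (subset_closure h')]
  have hF : ∀ z, F z * (algebraMap ℂ B z - a) = E * (1 - E) := by
    intro z
    by_cases hz : z ∈ U
    · rw [hFU z hz, mul_assoc, C.resolventCauchyTransform_mul_sub_of_mem hz]
    · by_cases hz' : z ∈ closure U
      · simp only [F, if_neg hz, if_pos hz']
        rw [mul_assoc, resolvent, Ring.inverse_mul_cancel, mul_one]
        exact C.mem_resolventSet_of_mem_frontier (C.isOpen.frontier_eq ▸ ⟨hz', hz⟩)
      · rw [hFe z hz', neg_mul, mul_assoc, C.resolventCauchyTransform_mul_sub_of_notMem hz',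
          mul_neg, neg_neg, sub_mul, mul_sub, one_mul, mul_one]
  -- The three branches agree wherever the resolvent exists, in particular near the boundary. A
  -- spectral point is in `U` or outside its closure, where a single holomorphic branch is valid.
  have hFr : ∀ z ∈ resolventSet ℂ a, F z = E * (1 - E) * resolvent a z := by
    intro z hz
    rw [← hF z, mul_assoc, resolvent, Ring.mul_inverse_cancel _ hz, mul_one]
  have hd : Differentiable ℂ F := by
    intro z
    by_cases hz : z ∈ resolventSet ℂ a
    · have : F =ᶠ[𝓝 z] fun z => E * (1 - E) * resolvent a z := by
        filter_upwards [(spectrum.isOpen_resolventSet a).mem_nhds hz] with w hw using hFr w hw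
      refine DifferentiableAt.congr_of_eventuallyEq ?_ this
      exact (spectrum.hasDerivAt_resolvent_const_left hz).differentiableAt.const_mul _
    · by_cases hzU : z ∈ U
      · have : F =ᶠ[𝓝 z] fun z => E * h z := by
          filter_upwards [C.isOpen.mem_nhds hzU] with w hw using hFU w hw
        refine DifferentiableAt.congr_of_eventuallyEq ?_ this
        exact (C.differentiableAt_resolventCauchyTransform (C.notMem_of_mem hzU)).const_mul _
      · have hzc : z ∉ closure U := fun hzc =>
          hz (C.mem_resolventSet_of_mem_frontier (C.isOpen.frontier_eq ▸ ⟨hzc, hzU⟩))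
        have : F =ᶠ[𝓝 z] fun z => -((1 - E) * h z) := by
          filter_upwards [isClosed_closure.isOpen_compl.mem_nhds hzc] with w hw using hFe w hw
        refine DifferentiableAt.congr_of_eventuallyEq ?_ this
        exact ((C.differentiableAt_resolventCauchyTransform
          (C.notMem_of_notMem_closure hzc)).const_mul _).neg
  have h0 := eq_zero_of_entire_mul_resolvent hd hF
  rw [mul_sub, mul_one, sub_eq_zero] at h0
  exact h0.symm

theorem commute_sub_resolventIntegral (z : ℂ) :
    Commute (algebraMap ℂ B z - a) (resolventIntegral a γ) :=
  C.commute_resolventIntegral (Commute.sub_left (Algebra.commutes z a) (Commute.refl a))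

/-- The Cauchy transform is itself the inverse here. For `invertibleOn` its negative serves outside
the closure, and boundary points are in the resolvent set. -/
theorem invertibleOn_one_sub {z : ℂ} (hz : z ∈ U) :
    InvertibleOn (algebraMap ℂ B z - a) (1 - resolventIntegral a γ) := by
  refine ⟨resolventCauchyTransform a γ z, C.resolventCauchyTransform_mul_sub_of_mem hz, ?_⟩
  rw [(C.commute_resolventCauchyTransform _ z (C.notMem_of_mem hz)).eq,
    C.resolventCauchyTransform_mul_sub_of_mem hz]
  exact Commute.sub_left (Algebra.commutes z a) (Commute.refl a)

theorem invertibleOn {z : ℂ} (hz : z ∉ U) :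
    InvertibleOn (algebraMap ℂ B z - a) (resolventIntegral a γ) := by
  by_cases hzc : z ∈ closure U
  · exact .of_isUnit (C.mem_resolventSet_of_mem_frontier (C.isOpen.frontier_eq ▸ ⟨hzc, hz⟩))
      (C.commute_sub_resolventIntegral z)
  · refine ⟨-resolventCauchyTransform a γ z, ?_, ?_⟩
    · rw [neg_mul, C.resolventCauchyTransform_mul_sub_of_notMem hzc, neg_neg]
    · rw [mul_neg, (C.commute_resolventCauchyTransform _ z (C.notMem_of_notMem_closure hzc)).eq,
        C.resolventCauchyTransform_mul_sub_of_notMem hzc, neg_neg]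
      exact Commute.sub_left (Algebra.commutes z a) (Commute.refl a)

end IsBoundaryCycle

end RieszIdempotent

open SpectralQuaternion

namespace SpectralQuaternion

open QInnerProductSpace

/-! ### Left scalar multiplication -/

section LeftMul

variable {V : Type*} [NormedAddCommGroup V] [NormedSpace ℝ V] [Module ℍ[ℝ]ᵐᵒᵖ V]
  [IsScalarTower ℝ ℍ[ℝ]ᵐᵒᵖ V] [QInnerProductSpace V] [CompleteSpace V] {ι : Type*}
  (F : QHilbertBasis ι V)

theorem leftMul_vec (q : ℍ[ℝ]) (k : ι) :
    leftMul F q (F.vec k) = MulOpposite.op q • F.vec k := by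
  change ∑' l, MulOpposite.op (q * qinner (F.vec l) (F.vec k)) • F.vec l = _
  rw [tsum_eq_single k]
  · rw [qinner_self, F.norm_eq_one]
    simp
  · intro l hl
    rw [F.qinner_eq_zero l k hl]
    simp

/-- Since left and right multiplication by `q` agree on basis vectors, this reduces the algebraic
laws of `leftMul` to right scalar multiplication. -/
theorem ext_vec {S S' : V →L[ℍ[ℝ]ᵐᵒᵖ] V} (h : ∀ k, S (F.vec k) = S' (F.vec k)) : S = S' :=
  ContinuousLinearMap.ext_on F.dense_span (by rintro _ ⟨k, rfl⟩; exact h k)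

theorem leftMul_mul (p q : ℍ[ℝ]) : leftMul F (p * q) = leftMul F p * leftMul F q :=
  ext_vec F fun k => by
    rw [mul_apply_eq_comp, leftMul_vec, leftMul_vec, map_smul, leftMul_vec, smul_smul,
      MulOpposite.op_mul]

theorem leftMul_add (p q : ℍ[ℝ]) : leftMul F (p + q) = leftMul F p + leftMul F q :=
  ext_vec F fun k => by
    rw [add_apply, leftMul_vec, leftMul_vec, leftMul_vec, MulOpposite.op_add,
      add_smul]

theorem leftMul_coe (r : ℝ) : leftMul F (r : ℍ[ℝ]) = r • (1 : V →L[ℍ[ℝ]ᵐᵒᵖ] V) :=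
  ext_vec F fun k => by
    rw [leftMul_vec, smul_apply, one_apply_eq_self, real_smul_eq]

theorem leftMul_slice (J : ℍ[ℝ]) (z : ℂ) :
    leftMul F (slice J z) = z.re • (1 : V →L[ℍ[ℝ]ᵐᵒᵖ] V) + z.im • leftMul F J := by
  rw [slice, leftMul_add, leftMul_mul, leftMul_coe, leftMul_coe, mul_smul_comm, mul_one]

end LeftMul

/-! ### Slices and spheres in the quaternions -/

section Slice

variable {J : ℍ[ℝ]}

theorem mul_self_of_mem_imUnits (hJ : J ∈ imUnits) : J * J = -1 := by
  obtain ⟨h1, h2⟩ := hJ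
  have h3 : star J = -J := by rw [Quaternion.star_eq_neg]; exact h1
  have h4 : star J * J = 1 := by
    rw [Quaternion.star_mul_self, Quaternion.normSq_eq_norm_mul_self, h2]; simp
  rw [h3, neg_mul] at h4
  rw [← h4, neg_neg]

theorem slice_mul (hJ : J ∈ imUnits) (z w : ℂ) : slice J (z * w) = slice J z * slice J w := by
  have h := mul_self_of_mem_imUnits hJ
  have hc : ∀ r : ℝ, (r : ℍ[ℝ]) * J = J * r := fun r => Quaternion.coe_commutes r J
  simp only [slice, Complex.mul_re, Complex.mul_im, Quaternion.coe_sub, Quaternion.coe_add,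
    Quaternion.coe_mul, add_mul, mul_add]
  have h1 : J * (z.im : ℍ[ℝ]) * (J * (w.im : ℍ[ℝ])) = -((z.im : ℍ[ℝ]) * w.im) := by
    rw [← hc, mul_assoc, ← mul_assoc J, h, neg_one_mul, mul_neg]
  have h2 : (z.re : ℍ[ℝ]) * (J * (w.im : ℍ[ℝ])) = J * (z.re * w.im) := by
    rw [← mul_assoc, hc, mul_assoc]
  rw [h1, h2]
  simp only [mul_assoc]
  abel

theorem re_slice (hJ : J ∈ imUnits) (z : ℂ) : (slice J z).re = z.re := by
  have h1 : J.re = 0 := hJ.1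
  simp [slice, h1]

theorem star_slice (hJ : J ∈ imUnits) (z : ℂ) :
    star (slice J z) = slice J ((starRingEnd ℂ) z) := by
  have h1 : star J = -J := by rw [Quaternion.star_eq_neg]; exact hJ.1
  rw [slice, slice, star_add, star_mul, Quaternion.star_coe, Quaternion.star_coe, h1,
    Quaternion.coe_commutes]
  simp

theorem slice_ofReal (r : ℝ) : slice J (r : ℂ) = r := by
  simp [slice]

theorem norm_slice (hJ : J ∈ imUnits) (z : ℂ) : ‖slice J z‖ = ‖z‖ := by
  have h1 : slice J z * star (slice J z) = ((‖z‖ ^ 2 : ℝ) : ℍ[ℝ]) := by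
    rw [star_slice hJ, ← slice_mul hJ, Complex.mul_conj, slice_ofReal, Complex.normSq_eq_norm_sq]
  rw [Quaternion.self_mul_star, Quaternion.coe_inj, Quaternion.normSq_eq_norm_mul_self, ← sq] at h1
  exact (pow_left_inj₀ (norm_nonneg _) (norm_nonneg _) two_ne_zero).1 h1

theorem im_slice (hJ : J ∈ imUnits) (z : ℂ) : (slice J z).im = J * z.im := by
  rw [← Quaternion.sub_re_self, re_slice hJ, slice, add_sub_cancel_left]

theorem norm_im_slice (hJ : J ∈ imUnits) (z : ℂ) : ‖(slice J z).im‖ = |z.im| := by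
  rw [im_slice hJ, norm_mul, hJ.2, one_mul, Quaternion.norm_coe, Real.norm_eq_abs]

theorem continuous_slice (J : ℍ[ℝ]) : Continuous (slice J) := by
  unfold slice
  exact (Quaternion.continuous_coe.comp Complex.continuous_re).add
    (continuous_const.mul (Quaternion.continuous_coe.comp Complex.continuous_im))

theorem coe_I_mem_imUnits : ((Complex.I : ℂ) : ℍ[ℝ]) ∈ imUnits := by
  refine ⟨by simp, ?_⟩
  have h := Quaternion.normSq_eq_norm_mul_self ((Complex.I : ℂ) : ℍ[ℝ])
  rw [Quaternion.normSq_def'] at h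
  simp only [Quaternion.re_coeComplex, Quaternion.imI_coeComplex, Quaternion.imJ_coeComplex,
    Quaternion.imK_coeComplex, Complex.I_re, Complex.I_im] at h
  nlinarith [norm_nonneg ((Complex.I : ℂ) : ℍ[ℝ])]

theorem mem_sphere_iff {p q : ℍ[ℝ]} : p ∈ sphere q ↔ p.re = q.re ∧ ‖p.im‖ = ‖q.im‖ := by
  constructor
  · rintro ⟨J, hJ, rfl⟩
    have := norm_im_slice hJ ⟨q.re, ‖q.im‖⟩
    have h2 := re_slice hJ ⟨q.re, ‖q.im‖⟩
    simp only [slice, abs_norm] at this h2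
    exact ⟨h2, this⟩
  · rintro ⟨h1, h2⟩
    -- A real `p` determines no imaginary direction; any unit will do, and `i` is taken.
    by_cases h0 : p.im = 0
    · refine ⟨((Complex.I : ℂ) : ℍ[ℝ]), coe_I_mem_imUnits, ?_⟩
      rw [← h2, h0, ← h1, norm_zero, Quaternion.coe_zero, mul_zero, add_zero]
      conv_lhs => rw [← Quaternion.re_add_im p, h0, add_zero]
    · have h3 : ‖p.im‖ ≠ 0 := norm_ne_zero_iff.2 h0
      refine ⟨p.im * ((‖p.im‖⁻¹ : ℝ) : ℍ[ℝ]), ⟨?_, ?_⟩, ?_⟩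
      · rw [Quaternion.mul_coe_eq_smul, Quaternion.re_smul, Quaternion.re_im, smul_zero]
      · rw [norm_mul, Quaternion.norm_coe, norm_inv, norm_norm, mul_inv_cancel₀ h3]
      · rw [← h1, ← h2, mul_assoc, ← Quaternion.coe_mul, inv_mul_cancel₀ h3, Quaternion.coe_one,
          mul_one, Quaternion.re_add_im]

end Slice

section Pencil

variable {V : Type*} [NormedAddCommGroup V] [NormedSpace ℝ V] [Module ℍ[ℝ]ᵐᵒᵖ V]
  [IsScalarTower ℝ ℍ[ℝ]ᵐᵒᵖ V]

theorem norm_sq_eq (q : ℍ[ℝ]) : ‖q‖ ^ 2 = q.re ^ 2 + ‖q.im‖ ^ 2 := by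
  have h1 := Quaternion.normSq_eq_norm_mul_self q
  have h2 := Quaternion.normSq_eq_norm_mul_self q.im
  rw [Quaternion.normSq_def'] at h1 h2
  simp at h1 h2
  rw [sq, sq, sq, ← h1, ← h2]
  ring

/-- The coefficients involve only `Re q` and `|q|`, which are constant on a sphere. Hence the
S-spectrum is axially symmetric. -/
theorem pencil_eq_of_mem_sphere (T : V →L[ℍ[ℝ]ᵐᵒᵖ] V) {p q : ℍ[ℝ]} (h : p ∈ sphere q) :
    pencil T p = pencil T q := by
  obtain ⟨h1, h2⟩ := mem_sphere_iff.1 h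
  rw [pencil, pencil, norm_sq_eq, norm_sq_eq q, h1, h2]

end Pencil

end SpectralQuaternion

namespace SpectralQuaternion

open QInnerProductSpace

/-! ### The underlying complex Banach space and its antilinear symmetry -/

section ComplexSpace

/-- The space `V` as a complex Banach space, `z` acting by right multiplication. -/
def ComplexSpace (V : Type*) := V

namespace ComplexSpace

variable {V : Type*}

instance [h : NormedAddCommGroup V] : NormedAddCommGroup (ComplexSpace V) := h

instance [NormedAddCommGroup V] [h : CompleteSpace V] : CompleteSpace (ComplexSpace V) := h

/-- The ring homomorphism `z ↦ op z`. -/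
noncomputable def opCoe : ℂ →+* ℍ[ℝ]ᵐᵒᵖ :=
  (Quaternion.ofComplex : ℂ →ₐ[ℝ] ℍ[ℝ]).toRingHom.toOpposite fun x y => by
    change Quaternion.ofComplex x * Quaternion.ofComplex y =
      Quaternion.ofComplex y * Quaternion.ofComplex x
    rw [← map_mul, ← map_mul, mul_comm]

variable [NormedAddCommGroup V] [NormedSpace ℝ V] [Module ℍ[ℝ]ᵐᵒᵖ V]
  [IsScalarTower ℝ ℍ[ℝ]ᵐᵒᵖ V]

instance : Module ℍ[ℝ]ᵐᵒᵖ (ComplexSpace V) := inferInstanceAs (Module ℍ[ℝ]ᵐᵒᵖ V)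

noncomputable instance : Module ℂ (ComplexSpace V) :=
  Module.compHom (M := V) opCoe

/-- The identity map. -/
def of : V → ComplexSpace V := id

theorem smul_def (z : ℂ) (v : ComplexSpace V) : z • v = MulOpposite.op (z : ℍ[ℝ]) • v := rfl

theorem of_op_smul (q : ℍ[ℝ]) (v : V) :
    of (MulOpposite.op q • v) = MulOpposite.op q • of v := rfl

theorem of_injective : Function.Injective (of : V → ComplexSpace V) := fun _ _ h => h

variable [QInnerProductSpace V]

noncomputable instance : NormedSpace ℂ (ComplexSpace V) where
  norm_smul_le z v := by
    have h := norm_op_smul (V := V) ((z : ℂ) : ℍ[ℝ]) v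
    have h2 : ‖((z : ℂ) : ℍ[ℝ])‖ = ‖z‖ := by
      have h3 := Quaternion.normSq_eq_norm_mul_self ((z : ℂ) : ℍ[ℝ])
      rw [Quaternion.normSq_def'] at h3
      simp only [Quaternion.re_coeComplex, Quaternion.imI_coeComplex, Quaternion.imJ_coeComplex,
        Quaternion.imK_coeComplex] at h3
      have h4 := Complex.normSq_eq_norm_sq z
      rw [Complex.normSq_apply] at h4
      refine (pow_left_inj₀ (norm_nonneg _) (norm_nonneg _) two_ne_zero).1 ?_
      rw [← h4, sq, ← h3]
      ring
    rw [h2] at h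
    exact h.le

theorem real_smul_of (r : ℝ) (v : V) : r • of v = of (r • v) := by
  rw [real_smul_eq r v]
  rfl

/-- The identity map as a real linear homeomorphism. -/
noncomputable def ofL : V ≃L[ℝ] ComplexSpace V where
  toFun := of
  invFun v := v
  map_add' _ _ := rfl
  map_smul' r v := (real_smul_of r v).symm
  left_inv _ := rfl
  right_inv _ := rfl
  continuous_toFun := continuous_id
  continuous_invFun := continuous_id

theorem ofL_apply (v : V) : ofL v = of v := rfl

/-- A right linear operator, as a complex linear operator. -/
noncomputable def lift : (V →L[ℍ[ℝ]ᵐᵒᵖ] V) →+* (ComplexSpace V →L[ℂ] ComplexSpace V) where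
  toFun S :=
    { toFun := fun v => of (S v)
      map_add' := fun v w => S.map_add v w
      map_smul' := fun z v => S.map_smul (MulOpposite.op (z : ℍ[ℝ])) v
      cont := S.cont }
  map_one' := rfl
  map_mul' _ _ := rfl
  map_zero' := rfl
  map_add' _ _ := rfl

theorem lift_of (S : V →L[ℍ[ℝ]ᵐᵒᵖ] V) (v : V) : lift S (of v) = of (S v) := rfl

theorem lift_injective : Function.Injective (lift : (V →L[ℍ[ℝ]ᵐᵒᵖ] V) → _) := by
  intro S S' h
  ext v
  exact of_injective (by rw [← lift_of, h, lift_of])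

theorem lift_smul (r : ℝ) (S : V →L[ℍ[ℝ]ᵐᵒᵖ] V) : lift (r • S) = (r : ℂ) • lift S := by
  ext v
  change of (r • S v) = _
  rw [real_smul_eq r (S v)]
  rfl

/-- The imaginary unit `j`. -/
def unitJ : ℍ[ℝ] := ⟨0, 0, 1, 0⟩

@[simp] theorem re_unitJ : unitJ.re = 0 := rfl
@[simp] theorem imI_unitJ : unitJ.imI = 0 := rfl
@[simp] theorem imJ_unitJ : unitJ.imJ = 1 := rfl
@[simp] theorem imK_unitJ : unitJ.imK = 0 := rfl

theorem unitJ_mul_unitJ : unitJ * unitJ = -1 := by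
  ext <;> simp

theorem coe_mul_unitJ (z : ℂ) :
    (z : ℍ[ℝ]) * unitJ = unitJ * (((starRingEnd ℂ) z : ℂ) : ℍ[ℝ]) := by
  ext <;> simp

theorem quaternion_eq (q : ℍ[ℝ]) : q = ((⟨q.re, q.imI⟩ : ℂ) : ℍ[ℝ]) +
    ((⟨q.imJ, q.imK⟩ : ℂ) : ℍ[ℝ]) * unitJ := by
  ext <;> simp

theorem op_unitJ_smul_smul (v : ComplexSpace V) :
    MulOpposite.op unitJ • MulOpposite.op unitJ • v = -v := by
  rw [smul_smul, ← MulOpposite.op_mul, unitJ_mul_unitJ, MulOpposite.op_neg, MulOpposite.op_one,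
    neg_one_smul]

/-- The antilinear map `v ↦ v j`. -/
noncomputable def mulJ : ComplexSpace V →SL[starRingEnd ℂ] ComplexSpace V where
  toFun v := MulOpposite.op unitJ • v
  map_add' v w := smul_add _ v w
  map_smul' z v := by
    rw [smul_def, smul_def, smul_smul, smul_smul, ← MulOpposite.op_mul, ← MulOpposite.op_mul,
      coe_mul_unitJ]
  cont := (rightMul V unitJ).cont

theorem mulJ_apply (v : ComplexSpace V) : mulJ v = MulOpposite.op unitJ • v := rfl

theorem mulJ_mulJ (v : ComplexSpace V) : mulJ (mulJ v) = -v := op_unitJ_smul_smul v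

/-- Conjugation of a complex linear operator by the antilinear map `v ↦ v j`. -/
noncomputable def conj : (ComplexSpace V →L[ℂ] ComplexSpace V) →+*
    (ComplexSpace V →L[ℂ] ComplexSpace V) where
  -- Since `j² = -1`, the inverse of `v ↦ v j` is its negative; the sign makes this a genuine
  -- conjugation.
  toFun S := -(mulJ.comp (S.comp mulJ))
  map_one' := by
    ext v
    change -mulJ (mulJ v) = v
    rw [mulJ_mulJ, neg_neg]
  map_mul' S S' := by
    ext v
    change -mulJ (S (S' (mulJ v))) = -mulJ (S (mulJ (-mulJ (S' (mulJ v)))))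
    rw [map_neg mulJ, mulJ_mulJ, neg_neg]
  map_zero' := by
    ext v
    change -mulJ (0 : ComplexSpace V) = 0
    rw [map_zero, neg_zero]
  map_add' S S' := by
    ext v
    change -mulJ (S (mulJ v) + S' (mulJ v)) = -mulJ (S (mulJ v)) + -mulJ (S' (mulJ v))
    rw [map_add, neg_add]

theorem conj_apply (S : ComplexSpace V →L[ℂ] ComplexSpace V) (v : ComplexSpace V) :
    conj S v = -mulJ (S (mulJ v)) := rfl

theorem lift_op_smul (S : V →L[ℍ[ℝ]ᵐᵒᵖ] V) (q : ℍ[ℝ]) (v : ComplexSpace V) :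
    lift S (MulOpposite.op q • v) = MulOpposite.op q • lift S v :=
  S.map_smul (MulOpposite.op q) v

theorem conj_lift (S : V →L[ℍ[ℝ]ᵐᵒᵖ] V) : conj (lift S) = lift S := by
  ext v
  rw [conj_apply, mulJ_apply v, lift_op_smul, ← mulJ_apply, mulJ_mulJ, neg_neg]

theorem conj_algebraMap (z : ℂ) :
    conj (algebraMap ℂ (ComplexSpace V →L[ℂ] ComplexSpace V) z) =
      algebraMap ℂ _ ((starRingEnd ℂ) z) := by
  ext v
  rw [conj_apply]
  change -mulJ (z • mulJ v) = (starRingEnd ℂ) z • v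
  rw [map_smulₛₗ, mulJ_mulJ, smul_neg, neg_neg]

theorem map_op_unitJ_of_conj_eq {S : ComplexSpace V →L[ℂ] ComplexSpace V} (h : conj S = S)
    (v : ComplexSpace V) : S (MulOpposite.op unitJ • v) = MulOpposite.op unitJ • S v := by
  conv_rhs => rw [← h, conj_apply, ← mulJ_apply, map_neg, mulJ_mulJ, neg_neg]
  rfl

/-- Every quaternion is `z + w j` with `z`, `w` complex, so compatibility with complex scalars and
with `j` suffices. -/
theorem map_op_smul_of_conj_eq {S : ComplexSpace V →L[ℂ] ComplexSpace V} (h : conj S = S)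
    (q : ℍ[ℝ]) (v : ComplexSpace V) :
    S (MulOpposite.op q • v) = MulOpposite.op q • S v := by
  rw [quaternion_eq q, MulOpposite.op_add, add_smul, add_smul, map_add, MulOpposite.op_mul,
    mul_smul, mul_smul, map_op_unitJ_of_conj_eq h, ← smul_def, ← smul_def, ← smul_def, ← smul_def,
    map_smul, map_smul]

/-- An operator fixed by conjugation is right quaternionic linear. -/
theorem exists_lift_eq {S : ComplexSpace V →L[ℂ] ComplexSpace V} (h : conj S = S) :
    ∃ S' : V →L[ℍ[ℝ]ᵐᵒᵖ] V, lift S' = S :=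
  ⟨{ toFun := fun v => S v
     map_add' := fun v w => S.map_add v w
     map_smul' := fun q v => map_op_smul_of_conj_eq h q.unop v
     cont := S.cont }, rfl⟩

/-- The conjugate of a normalised inverse of a lifted operator is another one; by uniqueness the
inverse is fixed by `conj` and so is quaternionic. -/
theorem invertibleOn_of_lift {a e : V →L[ℍ[ℝ]ᵐᵒᵖ] V} (h : InvertibleOn (lift a) (lift e))
    (he : IsIdempotentElem e) (ha : Commute a e) : InvertibleOn a e := by
  obtain ⟨g, h1, h2, h3, h4⟩ := h.exists_normalized (he.map lift) (ha.map lift)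
  have h1' := congrArg conj h1
  have h3' := congrArg conj h3
  rw [map_mul, conj_lift, conj_lift] at h1'
  rw [map_mul, conj_lift] at h3'
  have hg : conj g = g := InvertibleOn.unique h1' h3' h2 h4
  obtain ⟨g', rfl⟩ := exists_lift_eq hg
  rw [← map_mul] at h1 h2
  exact ⟨g', lift_injective h1, lift_injective h2⟩

theorem invertibleOn_conj {T : V →L[ℍ[ℝ]ᵐᵒᵖ] V} {e : ComplexSpace V →L[ℂ] ComplexSpace V} {z : ℂ}
    (h : InvertibleOn (algebraMap ℂ _ ((starRingEnd ℂ) z) - lift T) e) :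
    InvertibleOn (algebraMap ℂ _ z - lift T) (conj e) := by
  have := h.map conj
  rwa [map_sub, conj_algebraMap, conj_lift, Complex.conj_conj] at this

/-- The pencil is a real quadratic polynomial in `T` with roots `z` and `z̄`, and complex scalars
commute with the lift of `T`. -/
theorem lift_pencil (T : V →L[ℍ[ℝ]ᵐᵒᵖ] V) {J : ℍ[ℝ]} (hJ : J ∈ imUnits) (z : ℂ) :
    lift (pencil T (slice J z)) =
      (algebraMap ℂ _ z - lift T) * (algebraMap ℂ _ ((starRingEnd ℂ) z) - lift T) := by
  rw [pencil, re_slice hJ, norm_slice hJ, map_add, map_sub, map_pow, lift_smul, lift_smul, map_one,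
    sub_mul, mul_sub, mul_sub, ← map_mul, Complex.mul_conj, Complex.normSq_eq_norm_sq,
    ← Algebra.commutes _ (lift T), sq, Algebra.algebraMap_eq_smul_one,
    Algebra.algebraMap_eq_smul_one, Algebra.algebraMap_eq_smul_one, smul_mul_assoc, smul_mul_assoc,
    one_mul]
  have h : ((2 * z.re : ℝ) : ℂ) = z + (starRingEnd ℂ) z := by
    rw [Complex.add_conj]
  rw [h, add_smul]
  push_cast
  abel

theorem commute_sub (T : ComplexSpace V →L[ℂ] ComplexSpace V) (z w : ℂ) :
    Commute (algebraMap ℂ _ z - T) (algebraMap ℂ _ w - T) :=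
  Commute.sub_left (Algebra.commutes _ _)
    (Commute.sub_right (Algebra.commutes _ _).symm (Commute.refl _))

theorem invertibleOn_sub_of_pencil {T e : V →L[ℍ[ℝ]ᵐᵒᵖ] V} {J : ℍ[ℝ]} (hJ : J ∈ imUnits) {z : ℂ}
    (h : InvertibleOn (pencil T (slice J z)) e) (he : IsIdempotentElem e) (hT : Commute T e) :
    InvertibleOn (algebraMap ℂ _ z - lift T) (lift e) := by
  have h1 := h.map lift
  rw [lift_pencil T hJ] at h1
  exact h1.of_mul (commute_sub _ _ _) (he.map lift)
    (Commute.sub_left (Algebra.commutes _ _) (hT.map lift))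

theorem commute_pencil {T e : V →L[ℍ[ℝ]ᵐᵒᵖ] V} (h : Commute T e) (q : ℍ[ℝ]) :
    Commute (pencil T q) e := by
  refine Commute.add_left (Commute.sub_left (h.pow_left 2) (h.smul_left _))
    ((Commute.one_left e).smul_left _)

/-- Forward, `z - T` is a factor of an invertible pencil. Backward, conjugating by `j` makes `z̄ -
T` invertible as well, and the inverse of the product descends to a quaternionic operator. -/
theorem isUnit_pencil_iff (T : V →L[ℍ[ℝ]ᵐᵒᵖ] V) {J : ℍ[ℝ]} (hJ : J ∈ imUnits) {z : ℂ} :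
    slice J z ∈ sResolventSet T ↔ z ∈ resolventSet ℂ (lift T) := by
  constructor
  · intro h
    have h1 : InvertibleOn (pencil T (slice J z)) 1 := .of_isUnit h (Commute.one_right _)
    have h2 := invertibleOn_sub_of_pencil hJ h1 IsIdempotentElem.one (Commute.one_right _)
    obtain ⟨g, h3, h4⟩ := h2
    rw [map_one] at h3 h4
    exact ⟨⟨_, g, h4, h3⟩, rfl⟩
  · intro h
    have h1 : InvertibleOn (algebraMap ℂ _ z - lift T) 1 := .of_isUnit h (Commute.one_right _)
    have h2 : InvertibleOn (algebraMap ℂ _ ((starRingEnd ℂ) z) - lift T) 1 := by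
      have := invertibleOn_conj (T := T) (e := 1) (z := (starRingEnd ℂ) z)
        (by rwa [Complex.conj_conj])
      rwa [map_one] at this
    have h3 := h1.mul h2 IsIdempotentElem.one (Commute.one_right _) (Commute.one_right _)
    rw [← lift_pencil T hJ, ← map_one lift] at h3
    obtain ⟨g, h4, h5⟩ := invertibleOn_of_lift h3 IsIdempotentElem.one (Commute.one_right _)
    exact ⟨⟨_, g, h5, h4⟩, rfl⟩

end ComplexSpace

end ComplexSpace

end SpectralQuaternion

/-- The product `e f` is an idempotent commuting with `a`, on whose range `a` would have empty
spectrum. -/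
theorem InvertibleOn.mul_eq_zero {B : Type*} [NormedRing B] [NormedAlgebra ℂ B] [CompleteSpace B]
    {a e f : B} (he : IsIdempotentElem e) (hf : IsIdempotentElem f) (hef : Commute e f)
    (hae : Commute a e) (haf : Commute a f)
    (h : ∀ z : ℂ, InvertibleOn (algebraMap ℂ B z - a) e ∨ InvertibleOn (algebraMap ℂ B z - a) f) :
    e * f = 0 := by
  have hc : ∀ {g : B}, Commute a g → ∀ z : ℂ, Commute (algebraMap ℂ B z - a) g := fun hg z =>
    Commute.sub_left (Algebra.commutes z _) hg
  refine eq_zero_of_forall_invertibleOn (a := a) (he.mul_of_commute hef hf) (hae.mul_right haf)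
    fun z => ?_
  rcases h z with h | h
  · rw [hef.eq]
    exact h.mul_left (hc haf z)
  · exact h.mul_left (hc hae z)

namespace SpectralQuaternion

open QInnerProductSpace ComplexSpace MeasureTheory

variable {V : Type*} [NormedAddCommGroup V] [NormedSpace ℝ V] [Module ℍ[ℝ]ᵐᵒᵖ V]
  [IsScalarTower ℝ ℍ[ℝ]ᵐᵒᵖ V] [QInnerProductSpace V] [CompleteSpace V]
  {T : V →L[ℍ[ℝ]ᵐᵒᵖ] V} {σ : Set ℍ[ℝ]}

theorem slice_conj_mem_sphere {J : ℍ[ℝ]} (hJ : J ∈ imUnits) (z : ℂ) :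
    slice J ((starRingEnd ℂ) z) ∈ sphere (slice J z) := by
  rw [mem_sphere_iff, re_slice hJ, re_slice hJ, norm_im_slice hJ, norm_im_slice hJ]
  simp

theorem neg_mul_op (a b : V →L[ℍ[ℝ]ᵐᵒᵖ] V) : -a * b = -(a * b) := neg_mul a b

theorem mul_neg_op (a b : V →L[ℍ[ℝ]ᵐᵒᵖ] V) : a * -b = -(a * b) := mul_neg a b

theorem sub_mul_op (a b c : V →L[ℍ[ℝ]ᵐᵒᵖ] V) : (a - b) * c = a * c - b * c := sub_mul a b c

theorem mul_sub_op (a b c : V →L[ℍ[ℝ]ᵐᵒᵖ] V) : a * (b - c) = a * b - a * c := mul_sub a b c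

/-! ### Symmetry of the complex Riesz projection -/

namespace RieszContour

theorem isBoundaryCycle (C : RieszContour T σ) :
    IsBoundaryCycle (lift T) (slice C.J ⁻¹' C.U) C.γ where
  contDiffOn := C.contDiffOn_γ
  mem_resolventSet j t ht := (isUnit_pencil_iff T C.J_mem).1 (C.mem_resolvent j t ht)
  isOpen := C.isOpen_U.preimage (continuous_slice C.J)
  frontier_eq := C.frontier_eq
  winding_eq_one := C.winding_eq_one
  winding_eq_zero := C.winding_eq_zero

theorem conj_mem (C : RieszContour T σ) {z : ℂ} (hz : z ∈ slice C.J ⁻¹' C.U) :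
    (starRingEnd ℂ) z ∈ slice C.J ⁻¹' C.U :=
  C.axiallySymmetric_U _ hz (slice_conj_mem_sphere C.J_mem z)

/-- Because `U` is stable under complex conjugation, `E` and its conjugate separate the spectrum in
the same way, and `InvertibleOn.mul_eq_zero` gives both inclusions. No symmetry of the parametrized
curves is used. -/
theorem conj_resolventIntegral (C : RieszContour T σ) :
    conj (resolventIntegral (lift T) C.γ) = resolventIntegral (lift T) C.γ := by
  have hC := C.isBoundaryCycle
  set E := resolventIntegral (lift T) C.γ with hE
  have hi : IsIdempotentElem E := hC.isIdempotentElem_resolventIntegral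
  have hi' : IsIdempotentElem (conj E) := hi.map conj
  have hT : Commute (lift T) E := hC.commute_resolventIntegral (Commute.refl _)
  have hT' : Commute (lift T) (conj E) := by
    have := hT.map conj
    rwa [conj_lift] at this
  have hE' : Commute (conj E) E := hC.commute_resolventIntegral hT'.symm
  have h1 : ∀ z ∉ slice C.J ⁻¹' C.U, InvertibleOn (algebraMap ℂ _ z - lift T) (conj E) :=
    fun z hz => invertibleOn_conj (hC.invertibleOn fun h => hz (by
      have := C.conj_mem h
      rwa [Complex.conj_conj] at this))
  have h2 : ∀ z ∈ slice C.J ⁻¹' C.U, InvertibleOn (algebraMap ℂ _ z - lift T) (1 - conj E) :=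
    fun z hz => by
      have := invertibleOn_conj (hC.invertibleOn_one_sub (C.conj_mem hz))
      rwa [map_sub, map_one] at this
  have h3 : E * (1 - conj E) = 0 := by
    refine InvertibleOn.mul_eq_zero hi hi'.one_sub ((Commute.one_right _).sub_right hE'.symm) hT
      ((Commute.one_right _).sub_right hT') fun z => ?_
    by_cases hz : z ∈ slice C.J ⁻¹' C.U
    · exact .inr (h2 z hz)
    · exact .inl (hC.invertibleOn hz)
  have h4 : (1 - E) * conj E = 0 := by
    refine InvertibleOn.mul_eq_zero hi.one_sub hi' ((Commute.one_left _).sub_left hE'.symm)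
      ((Commute.one_right _).sub_right hT) hT' fun z => ?_
    by_cases hz : z ∈ slice C.J ⁻¹' C.U
    · exact .inl (hC.invertibleOn_one_sub hz)
    · exact .inr (h1 z hz)
  rw [mul_sub, mul_one, sub_eq_zero] at h3
  rw [sub_mul, one_mul, sub_eq_zero] at h4
  rw [h4, ← h3]

end RieszContour

/-! ### Comparison of the quaternionic and complex integrands -/

section Integrand

variable (T) (J : ℍ[ℝ])

/-- The coefficient of `1` in the integrand of the Riesz projection. -/
noncomputable def integrandRe (z w : ℂ) : V →L[ℍ[ℝ]ᵐᵒᵖ] V :=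
  Ring.inverse (pencil T (slice J z)) *
    (((starRingEnd ℂ) z * (w * -Complex.I)).re • 1 - (w * -Complex.I).re • T)

/-- The coefficient of the imaginary unit in the integrand of the Riesz projection. -/
noncomputable def integrandIm (z w : ℂ) : V →L[ℍ[ℝ]ᵐᵒᵖ] V :=
  Ring.inverse (pencil T (slice J z)) *
    (((starRingEnd ℂ) z * (w * -Complex.I)).im • 1 - (w * -Complex.I).im • T)

variable {J}

theorem slice_mul_neg (hJ : J ∈ imUnits) (w : ℂ) :
    -(slice J w) * J = slice J (w * -Complex.I) := by
  have h : J = slice J Complex.I := by simp [slice]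
  rw [mul_neg, ← neg_mul, slice_mul hJ, ← h]
  congr 1
  simp [slice]
  abel

/-- The product of `q̄` with `dq_J` stays in the slice, so it has components along `1` and `J`. Left
multiplication by `J` need not commute with `T`, but it can be kept on the far right. -/
theorem rieszIntegrand_eq {ι : Type*} (F : QHilbertBasis ι V) (hJ : J ∈ imUnits) (c : ℝ → ℂ)
    (t : ℝ) : rieszIntegrand F T J c t =
      (integrandRe T J (c t) (deriv c t)).restrictScalars ℝ +
      (integrandIm T J (c t) (deriv c t)).restrictScalars ℝ *
        (leftMul F J).restrictScalars ℝ := by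
  set z := c t
  set w := deriv c t
  have h : sResolventLeft F T (slice J z) * leftMul F (-(slice J w) * J) =
      integrandRe T J z w + integrandIm T J z w * leftMul F J := by
    rw [sResolventLeft, slice_mul_neg hJ, star_slice hJ, integrandRe, integrandIm,
      neg_mul_op, mul_assoc, sub_mul_op, ← leftMul_mul, ← slice_mul hJ, leftMul_slice,
      leftMul_slice, mul_assoc, ← mul_add, ← mul_neg_op]
    congr 1
    rw [sub_mul_op, mul_add, smul_mul_assoc, smul_mul_assoc, one_mul, mul_smul_comm,
      mul_smul_comm, mul_one]
    ext v
    change -((_ : V) + _ - (_ + _)) = _ - _ + (_ - _)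
    abel
  rw [rieszIntegrand, h]
  rfl

/-- From `(z - T)⁻¹ = Q⁻¹ (z̄ - T)` and `w = i u` with `u = -i w`: the same two components appear,
with the scalar `i` in place of `J`. The outer `i` will cancel the one in `1 / (2πi)`. -/
theorem smul_resolvent_apply (hJ : J ∈ imUnits) {z : ℂ} (hz : slice J z ∈ sResolventSet T)
    (w : ℂ) (v : V) :
    (w • resolvent (lift T) z) (of v) =
      Complex.I • (of (integrandRe T J z w v) + Complex.I • of (integrandIm T J z w v)) := by
  have hz' := (isUnit_pencil_iff T hJ).1 hz
  have h1 : resolvent (lift T) z = lift (Ring.inverse (pencil T (slice J z))) *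
      (algebraMap ℂ _ ((starRingEnd ℂ) z) - lift T) := by
    have h2 : lift (Ring.inverse (pencil T (slice J z))) * lift (pencil T (slice J z)) = 1 := by
      rw [← map_mul, Ring.inverse_mul_cancel _ hz, map_one]
    rw [lift_pencil T hJ] at h2
    have h3 := (commute_sub (lift T) z ((starRingEnd ℂ) z)).eq
    rw [h3] at h2
    calc resolvent (lift T) z = 1 * resolvent (lift T) z := (one_mul _).symm
      _ = _ := by
        rw [← h2, mul_assoc, mul_assoc, resolvent, Ring.mul_inverse_cancel _ hz', mul_one]
  set K := Ring.inverse (pencil T (slice J z)) with hK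
  set u := w * -Complex.I with hu
  have hw : w = Complex.I * u := by
    rw [hu, mul_comm w, ← mul_assoc, mul_neg, Complex.I_mul_I, neg_neg, one_mul]
  have hX : ∀ r s : ℝ, of ((K * (r • (1 : V →L[ℍ[ℝ]ᵐᵒᵖ] V) - s • T)) v) =
      lift K ((r : ℂ) • of v - (s : ℂ) • of (T v)) := by
    intro r s
    rw [← lift_of, map_mul, map_sub, lift_smul, lift_smul, map_one]
    rfl
  have h4 : ∀ c : ℂ, (c.re : ℂ) + Complex.I * c.im = c := fun c => by
    rw [mul_comm]; exact Complex.re_add_im c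
  rw [integrandRe, integrandIm, ← hK, ← hu, hX, hX, ← map_smul, ← map_add, h1]
  change w • lift K ((starRingEnd ℂ) z • of v - of (T v)) = _
  rw [hw, mul_smul, ← map_smul]
  congr 2
  rw [smul_sub, smul_sub, smul_smul, smul_smul, smul_smul, sub_add_sub_comm, ← add_smul, ← add_smul,
    h4, h4, mul_comm u]

end Integrand

/-! ### Comparison of the integrals -/

section Integrals

open intervalIntegral

variable {J : ℍ[ℝ]} {c : ℝ → ℂ}

theorem restrictScalars_ringInverse {S : V →L[ℍ[ℝ]ᵐᵒᵖ] V} (h : IsUnit S) :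
    (Ring.inverse S).restrictScalars ℝ = Ring.inverse (S.restrictScalars ℝ) := by
  obtain ⟨u, rfl⟩ := h
  rw [Ring.inverse_unit]
  let u' : (V →L[ℝ] V)ˣ := ⟨(u : V →L[ℍ[ℝ]ᵐᵒᵖ] V).restrictScalars ℝ,
    ((u⁻¹ : (V →L[ℍ[ℝ]ᵐᵒᵖ] V)ˣ) : V →L[ℍ[ℝ]ᵐᵒᵖ] V).restrictScalars ℝ,
    congrArg (ContinuousLinearMap.restrictScalars ℝ) u.mul_inv,
    congrArg (ContinuousLinearMap.restrictScalars ℝ) u.inv_mul⟩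
  exact (Ring.inverse_unit u').symm

/-- The integrals live in the Banach algebra of real operators, so continuity is proved there, from
continuity of inversion at units. -/
theorem continuousOn_inverse_pencil (hc : ContinuousOn c (Set.Icc 0 1))
    (hmem : ∀ t ∈ Set.Icc (0 : ℝ) 1, slice J (c t) ∈ sResolventSet T) :
    ContinuousOn (fun t => (Ring.inverse (pencil T (slice J (c t)))).restrictScalars ℝ)
      (Set.Icc 0 1) := by
  have hs := (continuous_slice J).comp_continuousOn hc
  have h1 : ContinuousOn (fun t => (pencil T (slice J (c t))).restrictScalars ℝ)
      (Set.Icc 0 1) := by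
    change ContinuousOn (fun t => (T.restrictScalars ℝ) ^ 2 -
      (2 * (slice J (c t)).re) • T.restrictScalars ℝ +
      (‖slice J (c t)‖ ^ 2) • (1 : V →L[ℝ] V)) (Set.Icc 0 1)
    have h2 := Quaternion.continuous_re.comp_continuousOn hs
    exact (continuousOn_const.sub ((continuousOn_const.mul h2).smul continuousOn_const)).add
      ((hs.norm.pow 2).smul continuousOn_const)
  refine ContinuousOn.congr (f := fun t =>
    Ring.inverse ((pencil T (slice J (c t))).restrictScalars ℝ)) ?_
    fun t ht => restrictScalars_ringInverse (hmem t ht)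
  intro t ht
  have hu : IsUnit ((pencil T (slice J (c t))).restrictScalars ℝ) := by
    obtain ⟨u, hu⟩ := hmem t ht
    rw [← hu]
    exact ⟨⟨(u : V →L[ℍ[ℝ]ᵐᵒᵖ] V).restrictScalars ℝ,
      ((u⁻¹ : (V →L[ℍ[ℝ]ᵐᵒᵖ] V)ˣ) : V →L[ℍ[ℝ]ᵐᵒᵖ] V).restrictScalars ℝ,
      congrArg (ContinuousLinearMap.restrictScalars ℝ) u.mul_inv,
      congrArg (ContinuousLinearMap.restrictScalars ℝ) u.inv_mul⟩, rfl⟩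
  obtain ⟨u, hu⟩ := hu
  have h3 := NormedRing.inverse_continuousAt u
  rw [hu] at h3
  exact ContinuousAt.comp_continuousWithinAt (g := Ring.inverse)
    (f := fun t => (pencil T (slice J (c t))).restrictScalars ℝ) h3 (h1 t ht)

theorem intervalIntegrable_clm_comp {E E' : Type*} [NormedAddCommGroup E] [NormedSpace ℝ E]
    [NormedAddCommGroup E'] [NormedSpace ℝ E'] (L : E →L[ℝ] E') {f : ℝ → E}
    (h : IntervalIntegrable f volume 0 1) :
    IntervalIntegrable (fun t => L (f t)) volume 0 1 :=
  ⟨L.integrable_comp h.1, L.integrable_comp h.2⟩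

theorem intervalIntegrable_re_deriv_smul {E : Type*} [NormedAddCommGroup E] [NormedSpace ℝ E]
    (hc : ContDiffOn ℝ 1 c (Set.Icc 0 1)) {f : ℝ → E} (hf : ContinuousOn f (Set.Icc 0 1)) :
    IntervalIntegrable (fun t => (deriv c t).re • f t) volume 0 1 :=
  (intervalIntegrable_clm_comp Complex.reCLM
    (intervalIntegrable_deriv_of_contDiffOn hc)).smul_continuousOn
      (by rwa [Set.uIcc_of_le zero_le_one])

theorem intervalIntegrable_im_deriv_smul {E : Type*} [NormedAddCommGroup E] [NormedSpace ℝ E]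
    (hc : ContDiffOn ℝ 1 c (Set.Icc 0 1)) {f : ℝ → E} (hf : ContinuousOn f (Set.Icc 0 1)) :
    IntervalIntegrable (fun t => (deriv c t).im • f t) volume 0 1 :=
  (intervalIntegrable_clm_comp Complex.imCLM
    (intervalIntegrable_deriv_of_contDiffOn hc)).smul_continuousOn
      (by rwa [Set.uIcc_of_le zero_le_one])

theorem intervalIntegrable_integrandRe (hc : ContDiffOn ℝ 1 c (Set.Icc 0 1))
    (hmem : ∀ t ∈ Set.Icc (0 : ℝ) 1, slice J (c t) ∈ sResolventSet T) :
    IntervalIntegrable (fun t => (integrandRe T J (c t) (deriv c t)).restrictScalars ℝ)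
      volume 0 1 := by
  have hK := continuousOn_inverse_pencil hc.continuousOn hmem
  have hre := Complex.continuous_re.comp_continuousOn hc.continuousOn
  have him := Complex.continuous_im.comp_continuousOn hc.continuousOn
  have h := (intervalIntegrable_im_deriv_smul hc ((hre.smul hK).sub
    (hK.mul (continuousOn_const (c := T.restrictScalars ℝ))))).sub
    (intervalIntegrable_re_deriv_smul hc (him.smul hK))
  refine h.congr fun t _ => ?_
  have h1 : ((starRingEnd ℂ) (c t) * (deriv c t * -Complex.I)).re =
      (c t).re * (deriv c t).im - (c t).im * (deriv c t).re := by simp; ring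
  have h2 : (deriv c t * -Complex.I).re = (deriv c t).im := by simp
  have key : integrandRe T J (c t) (deriv c t) = (deriv c t).im •
      ((c t).re • Ring.inverse (pencil T (slice J (c t))) -
        Ring.inverse (pencil T (slice J (c t))) * T) -
      (deriv c t).re • (c t).im • Ring.inverse (pencil T (slice J (c t))) := by
    ext v
    change (Ring.inverse (pencil T (slice J (c t)))) ((_ : ℝ) • v - (_ : ℝ) • T v) = (_ : ℝ) •
      ((_ : ℝ) • (Ring.inverse (pencil T (slice J (c t)))) v -
        (Ring.inverse (pencil T (slice J (c t)))) (T v)) - (_ : ℝ) • (_ : ℝ) •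
          (Ring.inverse (pencil T (slice J (c t)))) v
    rw [h1, h2, map_sub, ContinuousLinearMap.map_smul_of_tower, ContinuousLinearMap.map_smul_of_tower]
    module
  rw [key]
  rfl

theorem intervalIntegrable_integrandIm (hc : ContDiffOn ℝ 1 c (Set.Icc 0 1))
    (hmem : ∀ t ∈ Set.Icc (0 : ℝ) 1, slice J (c t) ∈ sResolventSet T) :
    IntervalIntegrable (fun t => (integrandIm T J (c t) (deriv c t)).restrictScalars ℝ)
      volume 0 1 := by
  have hK := continuousOn_inverse_pencil hc.continuousOn hmem
  have hre := Complex.continuous_re.comp_continuousOn hc.continuousOn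
  have him := Complex.continuous_im.comp_continuousOn hc.continuousOn
  have h := (intervalIntegrable_re_deriv_smul hc ((hK.mul
    (continuousOn_const (c := T.restrictScalars ℝ))).sub (hre.smul hK))).sub
    (intervalIntegrable_im_deriv_smul hc (him.smul hK))
  refine h.congr fun t _ => ?_
  have h1 : ((starRingEnd ℂ) (c t) * (deriv c t * -Complex.I)).im =
      -((c t).re * (deriv c t).re) - (c t).im * (deriv c t).im := by simp; ring
  have h2 : (deriv c t * -Complex.I).im = -(deriv c t).re := by simp
  have key : integrandIm T J (c t) (deriv c t) = (deriv c t).re •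
      (Ring.inverse (pencil T (slice J (c t))) * T -
        (c t).re • Ring.inverse (pencil T (slice J (c t)))) -
      (deriv c t).im • (c t).im • Ring.inverse (pencil T (slice J (c t))) := by
    ext v
    change (Ring.inverse (pencil T (slice J (c t)))) ((_ : ℝ) • v - (_ : ℝ) • T v) = (_ : ℝ) •
      ((Ring.inverse (pencil T (slice J (c t)))) (T v) -
        (_ : ℝ) • (Ring.inverse (pencil T (slice J (c t)))) v) - (_ : ℝ) • (_ : ℝ) •
          (Ring.inverse (pencil T (slice J (c t)))) v
    rw [h1, h2, map_sub, ContinuousLinearMap.map_smul_of_tower, ContinuousLinearMap.map_smul_of_tower]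
    module
  rw [key]
  rfl

namespace RieszContour

variable (C : RieszContour T σ)

/-- The component of the Riesz integral along `1`. -/
noncomputable def integralRe : V →L[ℝ] V := (2 * Real.pi)⁻¹ • ∑ j, ∫ t in (0 : ℝ)..1,
  (integrandRe T C.J (C.γ j t) (deriv (C.γ j) t)).restrictScalars ℝ

/-- The component of the Riesz integral along the imaginary unit. -/
noncomputable def integralIm : V →L[ℝ] V := (2 * Real.pi)⁻¹ • ∑ j, ∫ t in (0 : ℝ)..1,
  (integrandIm T C.J (C.γ j t) (deriv (C.γ j) t)).restrictScalars ℝ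

theorem rieszIntegral_eq {ι : Type*} (F : QHilbertBasis ι V) :
    rieszIntegral F T C = C.integralRe + C.integralIm * (leftMul F C.J).restrictScalars ℝ := by
  rw [rieszIntegral, integralRe, integralIm, smul_mul_assoc, ← smul_add, Finset.sum_mul,
    ← Finset.sum_add_distrib]
  congr 1
  refine Finset.sum_congr rfl fun j _ => ?_
  have hX := intervalIntegrable_integrandRe (C.contDiffOn_γ j) (C.mem_resolvent j)
  have hY := intervalIntegrable_integrandIm (C.contDiffOn_γ j) (C.mem_resolvent j)
  let R := (ContinuousLinearMap.mul ℝ (V →L[ℝ] V)).flip ((leftMul F C.J).restrictScalars ℝ)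
  have h1 := R.intervalIntegral_comp_comm hY
  have h2 := intervalIntegrable_clm_comp R hY
  change _ = _ + R _
  rw [← h1, ← intervalIntegral.integral_add hX h2]
  exact integral_congr fun t _ => rieszIntegrand_eq T F C.J_mem _ _

theorem resolventIntegral_apply (v : V) : resolventIntegral (lift T) C.γ (of v) =
    of (C.integralRe v) + Complex.I • of (C.integralIm v) := by
  have hsum : ∀ (A : Fin C.n → ℝ → V →L[ℝ] V), of (((2 * Real.pi)⁻¹ •
      ∑ j, ∫ t in (0 : ℝ)..1, A j t) v) =
      ((2 * Real.pi : ℝ) : ℂ)⁻¹ • ∑ j, of ((∫ t in (0 : ℝ)..1, A j t) v) := by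
    intro A
    have h := map_sum (ofL : V ≃L[ℝ] ComplexSpace V)
      (fun j => (∫ t in (0 : ℝ)..1, A j t) v) Finset.univ
    simp only [ofL_apply] at h
    rw [smul_apply, sum_apply, ← h, ← Complex.ofReal_inv, ← real_smul_of]
    rfl
  rw [integralRe, integralIm, hsum, hsum, resolventIntegral]
  rw [smul_comm Complex.I, ← smul_add, Finset.smul_sum (r := Complex.I),
    ← Finset.sum_add_distrib, smul_apply, sum_apply]
  have hpi : (2 * Real.pi * Complex.I : ℂ)⁻¹ = ((2 * Real.pi : ℝ) : ℂ)⁻¹ * Complex.I⁻¹ := by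
    push_cast
    rw [mul_inv]
  rw [hpi, mul_smul]
  congr 1
  rw [Finset.smul_sum]
  refine Finset.sum_congr rfl fun j _ => ?_
  have hX := intervalIntegrable_integrandRe (C.contDiffOn_γ j) (C.mem_resolvent j)
  have hY := intervalIntegrable_integrandIm (C.contDiffOn_γ j) (C.mem_resolvent j)
  have hev : ∀ A : ℝ → V →L[ℝ] V, IntervalIntegrable A volume 0 1 →
      IntervalIntegrable (fun t => ofL (A t v)) volume 0 1 ∧
      of ((∫ t in (0 : ℝ)..1, A t) v) = ∫ t in (0 : ℝ)..1, ofL (A t v) := by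
    intro A hA
    let L := ((ofL : V ≃L[ℝ] ComplexSpace V) : V →L[ℝ] ComplexSpace V).comp
      (ContinuousLinearMap.apply ℝ V v)
    exact ⟨intervalIntegrable_clm_comp L hA, (L.intervalIntegral_comp_comm hA).symm⟩
  obtain ⟨hX1, hX2⟩ := hev _ hX
  obtain ⟨hY1, hY2⟩ := hev _ hY
  rw [hX2, hY2, ← intervalIntegral.integral_smul, ← intervalIntegral.integral_add hX1
    (show IntervalIntegrable (fun t => Complex.I • ofL _) volume 0 1 from hY1.smul Complex.I), ContinuousLinearMap.intervalIntegral_apply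
      (C.isBoundaryCycle.intervalIntegrable j), ← intervalIntegral.integral_smul]
  refine integral_congr fun t ht => ?_
  rw [Set.uIcc_of_le zero_le_one] at ht
  change Complex.I⁻¹ • (deriv (C.γ j) t • resolvent (lift T) (C.γ j t)) (of v) = _
  rw [smul_resolvent_apply T C.J_mem (C.mem_resolvent j t ht), smul_smul,
    inv_mul_cancel₀ Complex.I_ne_zero, one_smul]
  rfl

theorem integral_op_smul {A : Fin C.n → ℝ → V →L[ℍ[ℝ]ᵐᵒᵖ] V} (q : ℍ[ℝ]) (v : V) :
    ((2 * Real.pi)⁻¹ • ∑ j, ∫ t in (0 : ℝ)..1, (A j t).restrictScalars ℝ)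
      (MulOpposite.op q • v) = MulOpposite.op q •
    ((2 * Real.pi)⁻¹ • ∑ j, ∫ t in (0 : ℝ)..1, (A j t).restrictScalars ℝ) v := by
  rw [smul_apply, smul_apply, sum_apply, sum_apply,
    smul_comm, Finset.smul_sum (r := MulOpposite.op q)]
  congr 1
  exact Finset.sum_congr rfl fun j _ => integral_comp_rightMul _ q v

/-- The complex integral `X + i Y` commutes with `v ↦ v j`, and so do `X` and `Y`, being integrals
of right linear operators. As `i` anticommutes with `j`, this gives `2 i (Y v) j = 0`. -/
theorem integralIm_eq_zero : C.integralIm = 0 := by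
  ext v
  have hE := map_op_unitJ_of_conj_eq C.conj_resolventIntegral (of v)
  rw [← of_op_smul, C.resolventIntegral_apply, C.resolventIntegral_apply,
    show C.integralRe (MulOpposite.op unitJ • v) = _ from C.integral_op_smul unitJ v,
    show C.integralIm (MulOpposite.op unitJ • v) = _ from C.integral_op_smul unitJ v,
    smul_add, of_op_smul, of_op_smul] at hE
  have h1 := add_left_cancel hE
  change Complex.I • MulOpposite.op unitJ • of (C.integralIm v) =
    MulOpposite.op unitJ • Complex.I • of (C.integralIm v) at h1
  have h2 : MulOpposite.op unitJ • Complex.I • of (C.integralIm v) =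
      -(Complex.I • MulOpposite.op unitJ • of (C.integralIm v)) := by
    rw [← mulJ_apply, map_smulₛₗ, Complex.conj_I, neg_smul, mulJ_apply]
  rw [h2, eq_neg_iff_add_eq_zero, ← two_smul ℂ, smul_eq_zero, smul_eq_zero] at h1
  have h3 : mulJ (of (C.integralIm v)) = 0 := by
    rcases h1 with h | h | h
    · norm_num at h
    · exact absurd h Complex.I_ne_zero
    · exact h
  have h4 := mulJ_mulJ (of (C.integralIm v))
  rw [h3, map_zero, eq_comm, neg_eq_zero] at h4
  exact h4

/-- The quaternionic Riesz projection is the complex Riesz projection. -/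
theorem lift_rieszProjection {ι : Type*} (F : QHilbertBasis ι V) :
    lift (rieszProjection F T C) = resolventIntegral (lift T) C.γ := by
  ext v
  change of (rieszIntegral F T C (v : V)) = resolventIntegral (lift T) C.γ (of v)
  have h := C.resolventIntegral_apply v
  rw [C.integralIm_eq_zero] at h
  rw [C.rieszIntegral_eq F, C.integralIm_eq_zero, zero_mul, add_zero, h]
  change _ = _ + Complex.I • (0 : ComplexSpace V)
  rw [smul_zero, add_zero]

end RieszContour

end Integrals

end SpectralQuaternion

/-! ### Restrictions to the range of an idempotent -/

section Restrict

variable {R M : Type*} [Ring R] [AddCommGroup M] [Module R M] [TopologicalSpace M]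
  [IsTopologicalAddGroup M] {S G : M →L[R] M}

theorem IsIdempotentElem.mem_range_iff_apply_eq (hG : IsIdempotentElem G) {v : M} :
    v ∈ G.range ↔ G v = v := by
  constructor
  · rintro ⟨w, rfl⟩
    exact congrArg (fun A : M →L[R] M => A w) hG.eq
  · intro h
    exact ⟨v, h⟩

/-- The inverse on `W` is precomposed with `G` and followed by the inclusion. Taking `w'` as a
separate variable in `h2` avoids building the restriction of `S` to `W` into the statement. -/
theorem InvertibleOn.of_inverse {W : Submodule R M} (hW : ∀ v, v ∈ W ↔ G v = v)
    (hG : IsIdempotentElem G) (hc : Commute S G) (g : W →L[R] W) (h1 : ∀ w, S (g w) = w)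
    (h2 : ∀ w w' : W, (w' : M) = S w → g w' = w) : InvertibleOn S G := by
  have hGW : ∀ v, G v ∈ W := fun v =>
    (hW _).2 (congrArg (fun A : M →L[R] M => A v) hG.eq)
  refine ⟨W.subtypeL.comp (g.comp (G.codRestrict W hGW)), ?_, ?_⟩
  · ext v
    have h3 : S (G v) = G (S v) := congrArg (fun A : M →L[R] M => A v) hc.eq
    exact congrArg Subtype.val (h2 ⟨G v, hGW v⟩ ⟨G (S v), hGW _⟩ h3.symm)
  · ext v
    exact h1 ⟨G v, hGW v⟩

theorem InvertibleOn.exists_inverse {W : Submodule R M} (hW : ∀ v, v ∈ W ↔ G v = v)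
    (hG : IsIdempotentElem G) (hc : Commute S G) (h : InvertibleOn S G) :
    ∃ g : W →L[R] W, (∀ w, S (g w) = w) ∧ ∀ w w' : W, (w' : M) = S w → g w' = w := by
  obtain ⟨k, h1, h2, h3, h4⟩ := h.exists_normalized hG hc
  refine ⟨k.restrict (p := W) (q := W) fun v _ => (hW _).2
    (congrArg (fun A : M →L[R] M => A v) h4), fun w => ?_, fun w w' hw => ?_⟩
  · exact (congrArg (fun A : M →L[R] M => A w) h2).trans ((hW _).1 w.2)
  · refine Subtype.ext ?_
    change k w' = w
    rw [hw]
    exact (congrArg (fun A : M →L[R] M => A w) h1).trans ((hW _).1 w.2)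

end Restrict

/-- A complex linear operator commuting with a finite rank idempotent has finitely many spectral
values on its range. -/
theorem finite_setOf_not_invertibleOn {E : Type*} [NormedAddCommGroup E] [NormedSpace ℂ E]
    {S G : E →L[ℂ] E} (hG : IsIdempotentElem G) (hc : Commute S G)
    [FiniteDimensional ℂ G.range] :
    {z : ℂ | ¬InvertibleOn (algebraMap ℂ _ z - S) G}.Finite := by
  have hW : ∀ v, v ∈ G.range ↔ G v = v := fun v => hG.mem_range_iff_apply_eq
  have hS : ∀ v ∈ G.range, S v ∈ G.range := fun v hv => (hW _).2 (by
    have h1 : S (G v) = G (S v) := congrArg (fun A : E →L[ℂ] E => A v) hc.eq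
    rw [← h1, (hW v).1 hv])
  let f : Module.End ℂ G.range := S.toLinearMap.restrict hS
  -- Off the spectrum of the restricted endomorphism there is an algebraic inverse, automatically
  -- continuous in finite dimension.
  refine (Module.End.finite_spectrum f).subset fun z hz => ?_
  by_contra hzf
  obtain ⟨u, hu⟩ := spectrum.notMem_iff.1 hzf
  have hval : ∀ w : G.range, (((u : Module.End ℂ G.range) w : G.range) : E) =
      (algebraMap ℂ (E →L[ℂ] E) z - S) w := fun w => by rw [hu]; rfl
  refine hz (InvertibleOn.of_inverse hW hG
    (Commute.sub_left (Algebra.commutes z G) hc)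
    (LinearMap.toContinuousLinearMap ((u⁻¹ : (Module.End ℂ G.range)ˣ) : Module.End ℂ G.range))
    (fun w => ?_) fun w w' hw => ?_)
  · rw [← hval]
    exact congrArg (fun A : Module.End ℂ G.range => (A w : E)) u.mul_inv
  · have h1 : w' = (u : Module.End ℂ G.range) w := Subtype.ext (hw.trans (hval w).symm)
    rw [h1]
    exact congrArg (fun A : Module.End ℂ G.range => A w) u.inv_mul

namespace SpectralQuaternion

open QInnerProductSpace ComplexSpace MeasureTheory

section RestrictPencil

variable {V : Type*} [NormedAddCommGroup V] [NormedSpace ℝ V] [Module ℍ[ℝ]ᵐᵒᵖ V]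
  [IsScalarTower ℝ ℍ[ℝ]ᵐᵒᵖ V] {T G : V →L[ℍ[ℝ]ᵐᵒᵖ] V}

theorem pencil_apply (S : V →L[ℍ[ℝ]ᵐᵒᵖ] V) (q : ℍ[ℝ]) (v : V) :
    pencil S q v = S (S v) - (2 * q.re) • S v + (‖q‖ ^ 2) • v := by
  rw [pencil, sq S]
  rfl

theorem pencil_restrict_apply {W : Submodule ℍ[ℝ]ᵐᵒᵖ V} (h : ∀ f ∈ W, T f ∈ W) (q : ℍ[ℝ])
    (w : W) : (pencil (T.restrict h) q w : V) = pencil T q w := by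
  rw [pencil_apply, pencil_apply]
  rfl

/-- The `S`-resolvent set of the restriction of `T` to the range of an idempotent. -/
theorem mem_sResolventSet_restrict_iff {W : Submodule ℍ[ℝ]ᵐᵒᵖ V} (h : ∀ f ∈ W, T f ∈ W)
    (hW : ∀ v, v ∈ W ↔ G v = v) (hG : IsIdempotentElem G) {q : ℍ[ℝ]}
    (hc : Commute (pencil T q) G) : q ∈ sResolventSet (T.restrict h) ↔ InvertibleOn (pencil T q) G := by
  constructor
  · rintro ⟨u, hu⟩
    refine InvertibleOn.of_inverse hW hG hc ((u⁻¹ : (W →L[ℍ[ℝ]ᵐᵒᵖ] W)ˣ) : W →L[ℍ[ℝ]ᵐᵒᵖ] W)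
      (fun w => ?_) fun w w' hw => ?_
    · rw [← pencil_restrict_apply h, ← hu]
      exact congrArg (fun A : W →L[ℍ[ℝ]ᵐᵒᵖ] W => (A w : V)) u.mul_inv
    · rw [← pencil_restrict_apply h, ← hu] at hw
      rw [Subtype.ext hw]
      exact congrArg (fun A : W →L[ℍ[ℝ]ᵐᵒᵖ] W => A w) u.inv_mul
  · intro hi
    obtain ⟨g, h1, h2⟩ := hi.exists_inverse hW hG hc
    refine ⟨⟨pencil (T.restrict h) q, g, ?_, ?_⟩, rfl⟩
    · ext w
      exact (pencil_restrict_apply h q _).trans (h1 w)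
    · ext w
      exact congrArg Subtype.val (h2 w _ (pencil_restrict_apply h q w))

end RestrictPencil

/-! ### Projections from invariant decompositions -/

section Projection

variable {V : Type*} [NormedAddCommGroup V] [NormedSpace ℝ V] [Module ℍ[ℝ]ᵐᵒᵖ V]
  [IsScalarTower ℝ ℍ[ℝ]ᵐᵒᵖ V] [CompleteSpace V] {T : V →L[ℍ[ℝ]ᵐᵒᵖ] V}

/-- The projection defined by two complementary closed invariant subspaces. -/
theorem exists_projection {V₁ V₂ : Submodule ℍ[ℝ]ᵐᵒᵖ V} (h₁ : ∀ f ∈ V₁, T f ∈ V₁)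
    (h₂ : ∀ f ∈ V₂, T f ∈ V₂) (hc₁ : IsClosed (V₁ : Set V)) (hc₂ : IsClosed (V₂ : Set V))
    (h : IsCompl V₁ V₂) : ∃ G : V →L[ℍ[ℝ]ᵐᵒᵖ] V, IsIdempotentElem G ∧ Commute T G ∧
      (∀ v, v ∈ V₁ ↔ G v = v) ∧ ∀ v, v ∈ V₂ ↔ (1 - G) v = v := by
  let π : V →ₗ[ℍ[ℝ]ᵐᵒᵖ] V := V₁.projection V₂ h
  have h' : IsCompl (V₁.restrictScalars ℝ) (V₂.restrictScalars ℝ) :=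
    (Submodule.isCompl_restrictScalars_iff ℝ).2 h
  have hπ₁ : ∀ v ∈ V₁, π v = v := fun v hv => by
    change ((V₁.projectionOnto V₂ h v : V₁) : V) = v
    rw [Submodule.projectionOnto_apply_of_mem_left h hv]
  have hπ₂ : ∀ v ∈ V₂, π v = 0 := fun v hv => by
    change ((V₁.projectionOnto V₂ h v : V₁) : V) = 0
    rw [(Submodule.projectionOnto_apply_eq_zero_iff h).2 hv]
    rfl
  have hdec : ∀ v, ∃ a ∈ V₁, ∃ b ∈ V₂, v = a + b := fun v => by
    have hv : v ∈ V₁ ⊔ V₂ := h.sup_eq_top ▸ Submodule.mem_top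
    obtain ⟨a, ha, b, hb, rfl⟩ := Submodule.mem_sup.1 hv
    exact ⟨a, ha, b, hb, rfl⟩
  -- Closed complements in a Banach space have a continuous projection; this is applied over the
  -- reals, and the real projection is identified with `π` through the decomposition of each vector.
  have hcont : Continuous π := by
    have h3 : Continuous fun v => (((V₁.restrictScalars ℝ).projectionOnto
        (V₂.restrictScalars ℝ) h' v : V₁.restrictScalars ℝ) : V) :=
      continuous_subtype_val.comp
        (Submodule.isTopCompl_iff_isCompl_isClosed.2 ⟨h', hc₁, hc₂⟩).continuous_projectionOnto
    refine h3.congr fun v => ?_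
    obtain ⟨a, ha, b, hb, rfl⟩ := hdec v
    rw [map_add, map_add, hπ₁ a ha, hπ₂ b hb,
      Submodule.projectionOnto_apply_of_mem_left h' (x := a) ha,
      (Submodule.projectionOnto_apply_eq_zero_iff h' (x := b)).2 hb, add_zero, add_zero]
  let G : V →L[ℍ[ℝ]ᵐᵒᵖ] V := ⟨π, hcont⟩
  have hG : ∀ a ∈ V₁, ∀ b ∈ V₂, G (a + b) = a := fun a ha b hb => by
    change π (a + b) = a
    rw [map_add, hπ₁ a ha, hπ₂ b hb, add_zero]
  have hmem : ∀ v, G v ∈ V₁ := fun v => by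
    obtain ⟨a, ha, b, hb, rfl⟩ := hdec v
    rwa [hG a ha b hb]
  refine ⟨G, ?_, ?_, fun v => ⟨fun hv => hπ₁ v hv, fun hv => hv ▸ hmem v⟩, fun v => ?_⟩
  · ext v
    exact hπ₁ _ (hmem v)
  · ext v
    change T (G v) = G (T v)
    obtain ⟨a, ha, b, hb, rfl⟩ := hdec v
    rw [hG a ha b hb, map_add, hG _ (h₁ a ha) _ (h₂ b hb)]
  · change v ∈ V₂ ↔ v - G v = v
    rw [sub_eq_self]
    refine ⟨fun hv => hπ₂ v hv, fun hv => ?_⟩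
    obtain ⟨a, ha, b, hb, rfl⟩ := hdec v
    rw [hG a ha b hb] at hv
    rwa [hv, zero_add]

end Projection

/-! ### Spectral properties of the quaternionic Riesz projection -/

section RieszProjection

variable {V : Type*} [NormedAddCommGroup V] [NormedSpace ℝ V] [Module ℍ[ℝ]ᵐᵒᵖ V]
  [IsScalarTower ℝ ℍ[ℝ]ᵐᵒᵖ V] [QInnerProductSpace V] [CompleteSpace V]
  {T : V →L[ℍ[ℝ]ᵐᵒᵖ] V} {σ : Set ℍ[ℝ]}

theorem self_mem_sphere (q : ℍ[ℝ]) : q ∈ sphere q := mem_sphere_iff.2 ⟨rfl, rfl⟩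

theorem mem_sphere_comm {p q : ℍ[ℝ]} : p ∈ sphere q ↔ q ∈ sphere p := by
  rw [mem_sphere_iff, mem_sphere_iff, eq_comm, eq_comm (a := ‖p.im‖)]

theorem sphere_eq_of_mem {p q : ℍ[ℝ]} (h : p ∈ sphere q) : sphere p = sphere q := by
  obtain ⟨h1, h2⟩ := mem_sphere_iff.1 h
  ext r
  rw [mem_sphere_iff, mem_sphere_iff, h1, h2]

theorem AxiallySymmetric.mem_iff {U : Set ℍ[ℝ]} (hU : AxiallySymmetric U) {p q : ℍ[ℝ]}
    (h : p ∈ sphere q) : p ∈ U ↔ q ∈ U :=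
  ⟨fun hp => hU p hp (mem_sphere_comm.1 h), fun hq => hU q hq h⟩

/-- The representative of the sphere of `q` in the upper half plane. -/
noncomputable def upper (q : ℍ[ℝ]) : ℂ := ⟨q.re, ‖q.im‖⟩

theorem slice_upper_mem_sphere {J : ℍ[ℝ]} (hJ : J ∈ imUnits) (q : ℍ[ℝ]) :
    slice J (upper q) ∈ sphere q := by
  rw [mem_sphere_iff, re_slice hJ, norm_im_slice hJ]
  simp [upper]

theorem eq_zero_of_invertibleOn {e f : V →L[ℍ[ℝ]ᵐᵒᵖ] V} (he : IsIdempotentElem e)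
    (hf : IsIdempotentElem f) (hef : Commute e f) (hTe : Commute T e) (hTf : Commute T f)
    (h : ∀ q, InvertibleOn (pencil T q) e ∨ InvertibleOn (pencil T q) f) : e * f = 0 := by
  apply lift_injective
  rw [map_mul, map_zero]
  refine InvertibleOn.mul_eq_zero (he.map lift) (hf.map lift) (hef.map lift) (hTe.map lift)
    (hTf.map lift) fun z => ?_
  rcases h (slice ((Complex.I : ℂ) : ℍ[ℝ]) z) with h | h
  · exact .inl (invertibleOn_sub_of_pencil coe_I_mem_imUnits h he hTe)
  · exact .inr (invertibleOn_sub_of_pencil coe_I_mem_imUnits h hf hTf)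

theorem invertibleOn_pencil {J : ℍ[ℝ]} (hJ : J ∈ imUnits) {z : ℂ} {e : V →L[ℍ[ℝ]ᵐᵒᵖ] V}
    (he : IsIdempotentElem e) (hT : Commute T e)
    (h1 : InvertibleOn (algebraMap ℂ _ z - lift T) (lift e))
    (h2 : InvertibleOn (algebraMap ℂ _ ((starRingEnd ℂ) z) - lift T) (lift e)) :
    InvertibleOn (pencil T (slice J z)) e := by
  have hc : ∀ w, Commute (algebraMap ℂ _ w - lift T) (lift e) := fun w =>
    Commute.sub_left (Algebra.commutes w _) (hT.map lift)
  refine invertibleOn_of_lift ?_ he (commute_pencil hT _)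
  rw [lift_pencil T hJ]
  exact h1.mul h2 (he.map lift) (hc _) (hc _)

namespace RieszContour

variable {ι : Type*} (F : QHilbertBasis ι V) (C : RieszContour T σ)

theorem isIdempotentElem : IsIdempotentElem (rieszProjection F T C) := by
  apply lift_injective
  rw [map_mul, lift_rieszProjection]
  exact C.isBoundaryCycle.isIdempotentElem_resolventIntegral

theorem commute {S : V →L[ℍ[ℝ]ᵐᵒᵖ] V} (h : Commute S T) :
    Commute S (rieszProjection F T C) := by
  apply lift_injective
  rw [map_mul, map_mul, lift_rieszProjection]
  exact C.isBoundaryCycle.commute_resolventIntegral (h.map lift)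

/-- A point of `U` off `σ` is in the resolvent set; a point off `U` has both of its representatives
`z`, `z̄` off the slice of `U`. Apart from idempotence and `commute`, this and
`invertibleOn_one_sub` are all that is used about the integral afterwards. -/
theorem invertibleOn {q : ℍ[ℝ]} (hq : q ∉ σ) :
    InvertibleOn (pencil T q) (rieszProjection F T C) := by
  have hT := C.commute F (Commute.refl T)
  by_cases hU : q ∈ C.U
  · refine .of_isUnit ?_ (commute_pencil hT q)
    by_contra h
    exact hq (C.inter_U ▸ ⟨hU, h⟩)
  · have hz : upper q ∉ slice C.J ⁻¹' C.U := fun h =>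
      hU ((C.axiallySymmetric_U.mem_iff (slice_upper_mem_sphere C.J_mem q)).1 h)
    have hz' : (starRingEnd ℂ) (upper q) ∉ slice C.J ⁻¹' C.U := fun h => hz (by
      have := C.conj_mem h
      rwa [Complex.conj_conj] at this)
    rw [← pencil_eq_of_mem_sphere T (slice_upper_mem_sphere C.J_mem q)]
    refine invertibleOn_pencil C.J_mem (C.isIdempotentElem F) hT ?_ ?_ <;>
      rw [lift_rieszProjection]
    · exact C.isBoundaryCycle.invertibleOn hz
    · exact C.isBoundaryCycle.invertibleOn hz'

theorem invertibleOn_one_sub {q : ℍ[ℝ]} (hq : q ∈ σ) :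
    InvertibleOn (pencil T q) (1 - rieszProjection F T C) := by
  have hT := C.commute F (Commute.refl T)
  have hU : q ∈ C.U := by
    rw [← C.inter_U] at hq
    exact hq.1
  have hz : upper q ∈ slice C.J ⁻¹' C.U :=
    (C.axiallySymmetric_U.mem_iff (slice_upper_mem_sphere C.J_mem q)).2 hU
  rw [← pencil_eq_of_mem_sphere T (slice_upper_mem_sphere C.J_mem q)]
  refine invertibleOn_pencil C.J_mem (C.isIdempotentElem F).one_sub
    (Commute.sub_right (Commute.one_right T) hT) ?_ ?_ <;>
    rw [map_sub, map_one, lift_rieszProjection]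
  · exact C.isBoundaryCycle.invertibleOn_one_sub hz
  · exact C.isBoundaryCycle.invertibleOn_one_sub (C.conj_mem hz)

theorem not_invertibleOn {q : ℍ[ℝ]} (hq : q ∈ σ) :
    ¬InvertibleOn (pencil T q) (rieszProjection F T C) := fun h => by
  have h1 : q ∈ sSpectrum T := by
    rw [← C.inter_U] at hq
    exact hq.2
  exact h1 (h.isUnit (C.invertibleOn_one_sub F hq))

end RieszContour

/-- A quaternionic subspace of finite dimension has finite complex dimension. -/
theorem finiteDimensional_range_lift {P : V →L[ℍ[ℝ]ᵐᵒᵖ] V}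
    (h : FiniteDimensional ℍ[ℝ]ᵐᵒᵖ P.range) : FiniteDimensional ℂ (lift P).range := by
  have h1 : Module.Finite ℝ P.range := Module.Finite.trans ℍ[ℝ]ᵐᵒᵖ _
  let f : P.range →ₗ[ℝ] (lift P).range :=
    { toFun := fun v => ⟨of (v : V), by
        obtain ⟨w, hw⟩ := v.2
        exact ⟨of w, hw⟩⟩
      map_add' := fun v w => rfl
      map_smul' := fun r v => Subtype.ext (real_smul_of r (v : V)).symm }
  have h2 : Module.Finite ℝ (lift P).range := Module.Finite.of_surjective f fun v => by
    obtain ⟨w, hw⟩ := v.2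
    exact ⟨⟨v.1, ⟨w, hw⟩⟩, rfl⟩
  exact Module.Finite.of_restrictScalars_finite ℝ ℂ _

/-- For `q` in `σ` the pencil is not invertible on the range, so one of its two linear factors is
not. Thus `upper q` or its conjugate is among the finitely many spectral values of the lift of `T`
there. -/
theorem finite_spheresOf {ι : Type*} (F : QHilbertBasis ι V) (C : RieszContour T σ)
    (h : FiniteDimensional ℍ[ℝ]ᵐᵒᵖ (rieszProjection F T C).range) : (spheresOf σ).Finite := by
  have hT := C.commute F (Commute.refl T)
  have hP := C.isIdempotentElem F
  have := finiteDimensional_range_lift h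
  have hfin := finite_setOf_not_invertibleOn (hP.map lift) (hT.map lift)
  refine ((hfin.union (hfin.image (starRingEnd ℂ))).image
    fun z => sphere (slice C.J z)).subset ?_
  rintro _ ⟨q, hq, rfl⟩
  have hs := slice_upper_mem_sphere C.J_mem q
  refine ⟨upper q, ?_, sphere_eq_of_mem hs⟩
  by_contra hz
  rw [Set.mem_union, not_or] at hz
  refine C.not_invertibleOn F hq ?_
  rw [← pencil_eq_of_mem_sphere T hs]
  refine invertibleOn_pencil C.J_mem hP hT (not_not.1 hz.1) ?_
  by_contra h'
  exact hz.2 ⟨_, h', Complex.conj_conj _⟩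

end RieszProjection

end SpectralQuaternion

/-! ### Boundaries of disjoint discs as cycles -/

section Discs

/-- The circle of centre `c` and radius `R`, parametrized by `[0, 1]`. -/
noncomputable def unitCircleMap (c : ℂ) (R : ℝ) (t : ℝ) : ℂ := circleMap c R (2 * Real.pi * t)

theorem contDiff_unitCircleMap (c : ℂ) (R : ℝ) : ContDiff ℝ 1 (unitCircleMap c R) :=
  (contDiff_circleMap c R).comp (contDiff_const.mul contDiff_id)

theorem image_unitCircleMap (c : ℂ) {R : ℝ} (hR : 0 ≤ R) :
    unitCircleMap c R '' Set.Icc 0 1 = Metric.sphere c R := by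
  refine Set.Subset.antisymm ?_ fun z hz => ?_
  · rintro _ ⟨t, -, rfl⟩
    exact circleMap_mem_sphere c hR _
  · rw [← abs_of_nonneg hR, ← image_circleMap_Ioc] at hz
    obtain ⟨θ, ⟨h1, h2⟩, rfl⟩ := hz
    have hpi := Real.two_pi_pos
    refine ⟨θ / (2 * Real.pi), ⟨by positivity, (div_le_one hpi).2 h2⟩, ?_⟩
    rw [unitCircleMap, mul_div_cancel₀ _ hpi.ne']

theorem injOn_unitCircleMap (c : ℂ) {R : ℝ} (hR : R ≠ 0) :
    Set.InjOn (unitCircleMap c R) (Set.Ico 0 1) := by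
  have hpi := Real.two_pi_pos
  have hmem : ∀ t ∈ Set.Ico (0 : ℝ) 1, 2 * Real.pi * t ∈ Set.Ico 0 (2 * Real.pi) := fun t ht =>
    ⟨mul_nonneg hpi.le ht.1, by nlinarith [ht.2]⟩
  intro s hs t ht h
  exact mul_left_cancel₀ hpi.ne' (injOn_circleMap_of_abs_sub_le' hR (by simp) (hmem s hs)
    (hmem t ht) h)

theorem deriv_unitCircleMap (c : ℂ) (R t : ℝ) : deriv (unitCircleMap c R) t =
    (2 * Real.pi : ℝ) • deriv (circleMap c R) (2 * Real.pi * t) := by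
  have h := (differentiable_circleMap c R (2 * Real.pi * t)).hasDerivAt.scomp t
    ((hasDerivAt_id t).const_mul (2 * Real.pi))
  rw [mul_one] at h
  exact h.deriv

theorem integral_deriv_unitCircleMap_div (c z : ℂ) (R : ℝ) :
    ∫ t in (0 : ℝ)..1, deriv (unitCircleMap c R) t / (unitCircleMap c R t - z) =
      ∮ w in C(c, R), (w - z)⁻¹ := by
  rw [circleIntegral]
  have h := intervalIntegral.smul_integral_comp_mul_left (a := 0) (b := 1)
    (fun θ => deriv (circleMap c R) θ • (circleMap c R θ - z)⁻¹) (2 * Real.pi)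
  rw [mul_zero, mul_one] at h
  rw [← h, ← intervalIntegral.integral_smul]
  refine intervalIntegral.integral_congr fun t _ => ?_
  simp only [deriv_unitCircleMap, unitCircleMap, smul_eq_mul, div_eq_mul_inv, smul_mul_assoc]

theorem integral_unitCircleMap_of_mem {c z : ℂ} {R : ℝ} (hz : z ∈ Metric.ball c R) :
    ∫ t in (0 : ℝ)..1, deriv (unitCircleMap c R) t / (unitCircleMap c R t - z) =
      2 * Real.pi * Complex.I := by
  rw [integral_deriv_unitCircleMap_div, circleIntegral.integral_sub_inv_of_mem_ball hz]

theorem integral_unitCircleMap_of_notMem {c z : ℂ} {R : ℝ} (hR : 0 ≤ R)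
    (hz : z ∉ Metric.closedBall c R) :
    ∫ t in (0 : ℝ)..1, deriv (unitCircleMap c R) t / (unitCircleMap c R t - z) = 0 := by
  rw [integral_deriv_unitCircleMap_div]
  have hne : ∀ w ∈ Metric.closedBall c R, w - z ≠ 0 := fun w hw h =>
    hz (sub_eq_zero.1 h ▸ hw)
  refine Complex.circleIntegral_eq_zero_of_differentiable_on_off_countable hR
    Set.countable_empty ?_ fun w hw => ?_
  · exact (continuousOn_id.sub continuousOn_const).inv₀ hne
  · exact (differentiableAt_id.sub_const z).inv (hne w (Metric.ball_subset_closedBall hw.1))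

variable {n : ℕ} {c : Fin n → ℂ} {R : ℝ}

theorem frontier_iUnion_ball (hR : R ≠ 0)
    (hd : Pairwise fun j k => Disjoint (Metric.closedBall (c j) R) (Metric.closedBall (c k) R)) :
    frontier (⋃ j, Metric.ball (c j) R) = ⋃ j, Metric.sphere (c j) R := by
  rw [(isOpen_iUnion fun j => Metric.isOpen_ball).frontier_eq, closure_iUnion_of_finite]
  simp only [closure_ball _ hR]
  ext z
  simp only [Set.mem_sdiff, Set.mem_iUnion, not_exists]
  constructor
  · rintro ⟨⟨j, hj⟩, h⟩
    exact ⟨j, le_antisymm hj (not_lt.1 (h j))⟩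
  · rintro ⟨j, hj⟩
    refine ⟨⟨j, Metric.sphere_subset_closedBall hj⟩, fun k hk => ?_⟩
    by_cases hjk : k = j
    · subst hjk
      exact absurd hj (ne_of_lt hk)
    · exact Set.disjoint_left.1 (hd hjk) (Metric.ball_subset_closedBall hk)
        (Metric.sphere_subset_closedBall hj)

theorem winding_iUnion_ball
    (hd : Pairwise fun j k => Disjoint (Metric.closedBall (c j) R) (Metric.closedBall (c k) R))
    {z : ℂ} (hz : z ∈ ⋃ j, Metric.ball (c j) R) :
    (2 * Real.pi * Complex.I : ℂ)⁻¹ * ∑ j, ∫ t in (0 : ℝ)..1,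
      deriv (unitCircleMap (c j) R) t / (unitCircleMap (c j) R t - z) = 1 := by
  obtain ⟨k, hk⟩ := Set.mem_iUnion.1 hz
  have hR : 0 ≤ R := dist_nonneg.trans hk.le
  rw [Finset.sum_eq_single k, integral_unitCircleMap_of_mem hk, inv_mul_cancel₀]
  · simp [Real.pi_ne_zero]
  · intro j _ hj
    exact integral_unitCircleMap_of_notMem hR fun h =>
      Set.disjoint_left.1 (hd hj) h (Metric.ball_subset_closedBall hk)
  · simp

theorem winding_iUnion_ball_of_notMem (hR : 0 < R)
    {z : ℂ} (hz : z ∉ closure (⋃ j, Metric.ball (c j) R)) :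
    (2 * Real.pi * Complex.I : ℂ)⁻¹ * ∑ j, ∫ t in (0 : ℝ)..1,
      deriv (unitCircleMap (c j) R) t / (unitCircleMap (c j) R t - z) = 0 := by
  rw [closure_iUnion_of_finite] at hz
  simp only [closure_ball _ hR.ne', Set.mem_iUnion, not_exists] at hz
  rw [Finset.sum_eq_zero fun j _ => integral_unitCircleMap_of_notMem hR.le (hz j), mul_zero]

end Discs

namespace SpectralQuaternion

open QInnerProductSpace ComplexSpace

/-! ### Isolated spheres and contours around them -/

section Isolated

variable {V : Type*} [NormedAddCommGroup V] [NormedSpace ℝ V] [Module ℍ[ℝ]ᵐᵒᵖ V]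
  [IsScalarTower ℝ ℍ[ℝ]ᵐᵒᵖ V] [QInnerProductSpace V] [CompleteSpace V]
  {T : V →L[ℍ[ℝ]ᵐᵒᵖ] V} {σ : Set ℍ[ℝ]}

theorem continuous_norm_im : Continuous fun q : ℍ[ℝ] => ‖q.im‖ := by
  have h : (fun q : ℍ[ℝ] => ‖q.im‖) = fun q : ℍ[ℝ] => ‖q - (q.re : ℍ[ℝ])‖ := by
    funext q
    rw [Quaternion.sub_re_self]
  rw [h]
  exact (continuous_id.sub (Quaternion.continuous_coe.comp Quaternion.continuous_re)).norm

theorem continuous_upper : Continuous upper :=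
  Complex.equivRealProdCLM.symm.continuous.comp
    (Quaternion.continuous_re.prodMk continuous_norm_im)

theorem mem_sphere_iff_upper {p q : ℍ[ℝ]} : p ∈ sphere q ↔ upper p = upper q := by
  rw [mem_sphere_iff, Complex.ext_iff]
  rfl

theorem isClosed_sphere (q : ℍ[ℝ]) : IsClosed (sphere q) := by
  have h : sphere q = upper ⁻¹' {upper q} := by
    ext p
    exact mem_sphere_iff_upper
  rw [h]
  exact isClosed_singleton.preimage continuous_upper

theorem mem_sResolventSet_iff_of_mem_sphere {p q : ℍ[ℝ]} (h : p ∈ sphere q) :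
    p ∈ sResolventSet T ↔ q ∈ sResolventSet T := by
  change IsUnit _ ↔ IsUnit _
  rw [pencil_eq_of_mem_sphere T h]

theorem isClosed_sSpectrum (T : V →L[ℍ[ℝ]ᵐᵒᵖ] V) : IsClosed (sSpectrum T) := by
  have h : sSpectrum T = upper ⁻¹' spectrum ℂ (lift T) := by
    ext q
    refine not_congr ?_
    rw [← mem_sResolventSet_iff_of_mem_sphere (slice_upper_mem_sphere coe_I_mem_imUnits q),
      isUnit_pencil_iff T coe_I_mem_imUnits]
  rw [h]
  exact (spectrum.isClosed (lift T)).preimage continuous_upper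

/-- The rest of the spectrum is the complement of `σ` together with the finitely many other spheres,
each of which is closed. -/
theorem isIsolatedPart_sphere (hσ : IsIsolatedPart T σ) (hax : AxiallySymmetric σ)
    (hfin : (spheresOf σ).Finite) {s : Set ℍ[ℝ]} (hs : s ∈ spheresOf σ) :
    IsIsolatedPart T s := by
  obtain ⟨q, hq, rfl⟩ := hs
  have hsub : sphere q ⊆ σ := hax q hq
  refine ⟨hsub.trans hσ.subset, (isClosed_sphere q).preimage continuous_subtype_val, ?_⟩
  have h : ((↑) ⁻¹' (sSpectrum T \ sphere q) : Set (sSpectrum T)) =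
      (↑) ⁻¹' (sSpectrum T \ σ) ∪ ⋃ s ∈ spheresOf σ \ {sphere q}, (↑) ⁻¹' s := by
    ext ⟨p, hp⟩
    simp only [Set.mem_preimage, Set.mem_sdiff, hp, true_and, Set.mem_union, Set.mem_iUnion,
      Set.mem_singleton_iff, exists_prop]
    constructor
    · intro h
      by_cases hpσ : p ∈ σ
      · exact .inr ⟨sphere p, ⟨⟨p, hpσ, rfl⟩, fun h' => h (h' ▸ self_mem_sphere p)⟩,
          self_mem_sphere p⟩
      · exact .inl hpσ
    · rintro (h | ⟨_, ⟨⟨r, hr, rfl⟩, h1⟩, h2⟩) h3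
      · exact h (hsub h3)
      · exact h1 ((sphere_eq_of_mem h2).symm.trans (sphere_eq_of_mem h3))
  rw [h]
  refine hσ.isClosed_diff.union ((hfin.subset Set.sdiff_subset).isClosed_biUnion ?_)
  rintro _ ⟨⟨r, hr, rfl⟩, -⟩
  exact (isClosed_sphere r).preimage continuous_subtype_val

theorem norm_upper (q : ℍ[ℝ]) : ‖upper q‖ = ‖q‖ := by
  have h := norm_sq_eq q
  have h2 := Complex.sq_norm (upper q)
  rw [Complex.normSq_apply] at h2
  refine (pow_left_inj₀ (norm_nonneg _) (norm_nonneg _) two_ne_zero).1 ?_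
  rw [h, h2, upper]
  ring

theorem upper_slice {J : ℍ[ℝ]} (hJ : J ∈ imUnits) (z : ℂ) :
    upper (slice J z) = ⟨z.re, |z.im|⟩ := by
  rw [upper, re_slice hJ, norm_im_slice hJ]

/-- Folding the plane onto the upper half plane brings points no farther from a point already there.
This shows that the slice of the neighbourhood chosen below is a union of two conjugate discs. -/
theorem dist_abs_im_le (z w : ℂ) (hw : 0 ≤ w.im) : dist (⟨z.re, |z.im|⟩ : ℂ) w ≤ dist z w := by
  rw [Complex.dist_eq_re_im, Complex.dist_eq_re_im]
  refine Real.sqrt_le_sqrt ?_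
  have h1 := sq_abs z.im
  have h2 := mul_le_mul_of_nonneg_right (le_abs_self z.im) hw
  simp only
  nlinarith

theorem dist_abs_im_le_conj (z w : ℂ) (hw : 0 ≤ w.im) :
    dist (⟨z.re, |z.im|⟩ : ℂ) w ≤ dist z ((starRingEnd ℂ) w) := by
  have h := dist_abs_im_le ((starRingEnd ℂ) z) w hw
  rwa [Complex.conj_re, Complex.conj_im, abs_neg, Complex.dist_conj_comm] at h

theorem dist_abs_im_eq (z w : ℂ) : dist (⟨z.re, |z.im|⟩ : ℂ) w = dist z w ∨
    dist (⟨z.re, |z.im|⟩ : ℂ) w = dist z ((starRingEnd ℂ) w) := by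
  rcases abs_choice z.im with h | h
  · left
    rw [h]
  · right
    rw [h, ← Complex.dist_conj_comm]
    rfl

/-- An isolated sphere of the spectrum is surrounded by a contour. -/
theorem nonempty_rieszContour_sphere {q : ℍ[ℝ]} (h : IsIsolatedPart T (sphere q)) :
    Nonempty (RieszContour T (sphere q)) := by
  classical
  set J : ℍ[ℝ] := ((Complex.I : ℂ) : ℍ[ℝ]) with hJdef
  have hJ : J ∈ imUnits := coe_I_mem_imUnits
  set z₀ := upper q with hz₀
  have hy : 0 ≤ z₀.im := norm_nonneg _
  have hK : IsClosed (sSpectrum T \ sphere q) := by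
    have h1 := (isClosed_sSpectrum T).isClosedEmbedding_subtypeVal.isClosedMap _ h.isClosed_diff
    rwa [Subtype.image_preimage_coe, Set.inter_eq_self_of_subset_right Set.sdiff_subset] at h1
  have hz₀K : z₀ ∈ (slice J ⁻¹' (sSpectrum T \ sphere q))ᶜ := fun h' =>
    h'.2 (slice_upper_mem_sphere hJ q)
  obtain ⟨r, hr, hball⟩ := Metric.isOpen_iff.1
    (hK.preimage (continuous_slice J)).isOpen_compl z₀ hz₀K
  -- `ε < r` keeps even the closed discs off the rest of the spectrum; `ε < z₀.im` keeps the two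
  -- conjugate closed discs disjoint.
  obtain ⟨ε, hε, hεr, hεy⟩ : ∃ ε > 0, ε < r ∧ (z₀.im ≠ 0 → ε < z₀.im) := by
    by_cases h0 : z₀.im = 0
    · exact ⟨r / 2, by positivity, by linarith, fun h' => absurd h0 h'⟩
    · have hy' : 0 < z₀.im := lt_of_le_of_ne hy (Ne.symm h0)
      refine ⟨min (r / 2) (z₀.im / 2), by positivity, ?_, fun _ => ?_⟩
      · exact (min_le_left _ _).trans_lt (by linarith)
      · exact (min_le_right _ _).trans_lt (by linarith)
  set U : Set ℍ[ℝ] := upper ⁻¹' Metric.ball z₀ ε with hU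
  have hax : AxiallySymmetric U := fun p hp p' hp' => by
    rw [hU, Set.mem_preimage, mem_sphere_iff_upper.1 hp']
    exact hp
  have hnear : ∀ p : ℍ[ℝ], upper p ∈ Metric.ball z₀ r → p ∈ sSpectrum T → p ∈ sphere q := by
    intro p hp hps
    have h1 := slice_upper_mem_sphere hJ p
    have h2 : slice J (upper p) ∈ sSpectrum T := fun h' =>
      hps ((mem_sResolventSet_iff_of_mem_sphere h1).1 h')
    by_contra h3
    refine hball hp ⟨h2, fun h4 => h3 ?_⟩
    rw [← sphere_eq_of_mem h4]
    exact mem_sphere_comm.1 h1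
  have hinter : U ∩ sSpectrum T = sphere q := by
    ext p
    refine ⟨fun hp => hnear p (Metric.ball_subset_ball hεr.le hp.1) hp.2, fun hp =>
      ⟨?_, h.subset hp⟩⟩
    rw [hU, Set.mem_preimage, mem_sphere_iff_upper.1 hp]
    exact Metric.mem_ball_self hε
  have hslice : slice J ⁻¹' U = Metric.ball z₀ ε ∪ Metric.ball ((starRingEnd ℂ) z₀) ε := by
    ext z
    rw [Set.mem_preimage, hU, Set.mem_preimage, upper_slice hJ, Set.mem_union, Metric.mem_ball,
      Metric.mem_ball, Metric.mem_ball]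
    constructor
    · intro h1
      rcases dist_abs_im_eq z z₀ with h2 | h2
      · exact .inl (h2 ▸ h1)
      · exact .inr (h2 ▸ h1)
    · rintro (h1 | h1)
      · exact (dist_abs_im_le z z₀ hy).trans_lt h1
      · exact (dist_abs_im_le_conj z z₀ hy).trans_lt h1
  -- For a real sphere the two discs coincide and the circle must be listed once only, or the
  -- winding number would be two.
  obtain ⟨n, c, hc, hcU, hd⟩ : ∃ (n : ℕ) (c : Fin n → ℂ),
      (∀ j, c j = z₀ ∨ c j = (starRingEnd ℂ) z₀) ∧
      slice J ⁻¹' U = ⋃ j, Metric.ball (c j) ε ∧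
      Pairwise fun j k => Disjoint (Metric.closedBall (c j) ε) (Metric.closedBall (c k) ε) := by
    by_cases h0 : z₀.im = 0
    · refine ⟨1, fun _ => z₀, fun _ => .inl rfl, ?_, fun j k hjk =>
        absurd (Subsingleton.elim j k) hjk⟩
      rw [hslice, Complex.conj_eq_iff_im.2 h0, Set.union_self, Set.iUnion_const]
    · have hdis : Disjoint (Metric.closedBall z₀ ε)
          (Metric.closedBall ((starRingEnd ℂ) z₀) ε) := by
        refine Metric.closedBall_disjoint_closedBall ?_
        rw [Complex.dist_self_conj, abs_of_nonneg hy]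
        linarith [hεy h0]
      refine ⟨2, ![z₀, (starRingEnd ℂ) z₀], ?_, ?_, ?_⟩
      · intro j
        fin_cases j
        · exact .inl rfl
        · exact .inr rfl
      · rw [hslice]
        ext z
        simp [Fin.exists_fin_two]
      · intro j k hjk
        fin_cases j <;> fin_cases k
        · exact absurd rfl hjk
        · exact hdis
        · exact hdis.symm
        · exact absurd rfl hjk
  have hfr := frontier_iUnion_ball hε.ne' hd
  -- A spectral point on a circle would be within `r` of `z₀` after folding, hence on the sphere of
  -- `q` and inside `U`; but boundary points of an open set are not in it.
  have hres : ∀ j, ∀ z ∈ Metric.sphere (c j) ε, slice J z ∈ sResolventSet T := by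
    intro j z hz
    by_contra hzs
    have hzU : slice J z ∉ U := by
      have h1 : z ∈ frontier (slice J ⁻¹' U) := by
        rw [hcU, hfr]
        exact Set.mem_iUnion.2 ⟨j, hz⟩
      have h2 : IsOpen (slice J ⁻¹' U) :=
        (Metric.isOpen_ball.preimage continuous_upper).preimage (continuous_slice J)
      rw [h2.frontier_eq] at h1
      exact h1.2
    have h3 : upper (slice J z) ∈ Metric.ball z₀ r := by
      rw [upper_slice hJ, Metric.mem_ball]
      have hz' : dist z (c j) = ε := hz
      rcases hc j with h4 | h4
      · exact (dist_abs_im_le z z₀ hy).trans_lt (by rw [← h4, hz']; exact hεr)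
      · exact (dist_abs_im_le_conj z z₀ hy).trans_lt (by rw [← h4, hz']; exact hεr)
    refine hzU ?_
    rw [hU, Set.mem_preimage, mem_sphere_iff_upper.1 (hnear _ h3 hzs)]
    exact Metric.mem_ball_self hε
  exact ⟨{
    U := U
    isOpen_U := Metric.isOpen_ball.preimage continuous_upper
    isBounded_U := by
      refine (Metric.isBounded_iff_subset_ball 0).2 ⟨‖z₀‖ + ε, fun p hp => ?_⟩
      rw [mem_ball_zero_iff, ← norm_upper]
      have h1 : ‖upper p - z₀‖ < ε := by
        rw [← dist_eq_norm]
        exact hp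
      calc ‖upper p‖ = ‖z₀ + (upper p - z₀)‖ := by rw [add_sub_cancel]
        _ ≤ ‖z₀‖ + ‖upper p - z₀‖ := norm_add_le _ _
        _ < ‖z₀‖ + ε := by linarith
    axiallySymmetric_U := hax
    inter_U := hinter
    J := J
    J_mem := hJ
    n := n
    γ := fun j => unitCircleMap (c j) ε
    contDiffOn_γ := fun j => (contDiff_unitCircleMap _ _).contDiffOn
    closed_γ := fun j => by simp [unitCircleMap, circleMap]
    injOn_γ := fun j => injOn_unitCircleMap _ hε.ne'
    frontier_eq := by
      rw [hcU, hfr]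
      simp only [image_unitCircleMap _ hε.le]
    mem_resolvent := fun j t ht => hres j _ (by
      rw [← image_unitCircleMap _ hε.le]
      exact ⟨t, ht, rfl⟩)
    winding_eq_one := fun z hz => winding_iUnion_ball hd (hcU ▸ hz)
    winding_eq_zero := fun z hz => winding_iUnion_ball_of_notMem hε (hcU ▸ hz) }⟩

end Isolated

end SpectralQuaternion

/-! ### Ranks of sums of orthogonal idempotents -/

section RankIdempotents

variable {R M : Type*} [DivisionRing R] [AddCommGroup M] [Module R M] [TopologicalSpace M]
  [IsTopologicalAddGroup M]

theorem rank_range_add_of_mul_eq_zero {P Q : M →L[R] M} (hP : IsIdempotentElem P)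
    (hQ : IsIdempotentElem Q) (hPQ : P * Q = 0) (hQP : Q * P = 0) :
    Module.rank R (P + Q).range = Module.rank R P.range + Module.rank R Q.range := by
  have hap : ∀ {A B : M →L[R] M}, A = B → ∀ v, A v = B v := fun h v => by rw [h]
  have hsup : (P + Q).range = P.range ⊔ Q.range := by
    apply le_antisymm
    · rintro _ ⟨v, rfl⟩
      exact Submodule.add_mem_sup ⟨v, rfl⟩ ⟨v, rfl⟩
    · refine sup_le ?_ ?_
      · rintro _ ⟨v, rfl⟩
        refine ⟨P v, ?_⟩
        have h1 := hap hP.eq v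
        have h2 := hap hQP v
        change P (P v) = P v at h1
        change Q (P v) = 0 at h2
        change P (P v) + Q (P v) = P v
        rw [h1, h2, add_zero]
      · rintro _ ⟨v, rfl⟩
        refine ⟨Q v, ?_⟩
        have h1 := hap hQ.eq v
        have h2 := hap hPQ v
        change Q (Q v) = Q v at h1
        change P (Q v) = 0 at h2
        change P (Q v) + Q (Q v) = Q v
        rw [h1, h2, zero_add]
  have hinf : P.range ⊓ Q.range = ⊥ := by
    rw [eq_bot_iff]
    rintro v ⟨h1, h2⟩
    rw [SetLike.mem_coe, hP.mem_range_iff_apply_eq] at h1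
    rw [SetLike.mem_coe, hQ.mem_range_iff_apply_eq] at h2
    rw [Submodule.mem_bot, ← h1, ← h2]
    exact hap hPQ v
  rw [hsup, ← Submodule.rank_sup_add_rank_inf_eq, hinf, rank_bot, add_zero]

theorem rank_range_sum_of_orthogonalIdempotents {I : Type*} {e : I → M →L[R] M}
    (he : OrthogonalIdempotents e) (s : Finset I) :
    Module.rank R (∑ i ∈ s, e i).range = ∑ i ∈ s, Module.rank R (e i).range := by
  classical
  induction s using Finset.induction_on with
  | empty =>
    rw [Finset.sum_empty, Finset.sum_empty]
    have h : (0 : M →L[R] M).range = ⊥ := LinearMap.range_zero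
    rw [h, rank_bot]
  | insert i s hi ih =>
    rw [Finset.sum_insert hi, Finset.sum_insert hi, ← ih]
    refine rank_range_add_of_mul_eq_zero (he.idem i) he.isIdempotentElem_sum ?_ ?_
    · rw [Finset.mul_sum]
      exact Finset.sum_eq_zero fun j hj => he.ortho (fun h => hi (h ▸ hj))
    · rw [Finset.sum_mul]
      exact Finset.sum_eq_zero fun j hj => he.ortho (fun h => hi (h ▸ hj))

theorem finiteDimensional_range_sum {I : Type*} [Fintype I] {e : I → M →L[R] M}
    (h : ∀ i, FiniteDimensional R (e i).range) : FiniteDimensional R (∑ i, e i).range := by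
  have hle : (∑ i, e i).range ≤ ⨆ i, (e i).range := by
    rintro _ ⟨v, rfl⟩
    change (∑ i, e i) v ∈ _
    rw [sum_apply]
    exact Submodule.sum_mem _ fun i _ => Submodule.mem_iSup_of_mem i ⟨v, rfl⟩
  exact Submodule.finiteDimensional_of_le hle

end RankIdempotents

namespace SpectralQuaternion

open QInnerProductSpace ComplexSpace

/-! ### Comparison of Riesz projections and eigenvalues of finite type -/

section FiniteType

variable {V : Type*} [NormedAddCommGroup V] [NormedSpace ℝ V] [Module ℍ[ℝ]ᵐᵒᵖ V]
  [IsScalarTower ℝ ℍ[ℝ]ᵐᵒᵖ V] [QInnerProductSpace V] [CompleteSpace V]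
  {T : V →L[ℍ[ℝ]ᵐᵒᵖ] V} {σ τ : Set ℍ[ℝ]} {ι : Type*} (F : QHilbertBasis ι V)

namespace RieszContour

theorem commute_self (C : RieszContour T σ) : Commute T (rieszProjection F T C) :=
  C.commute F (Commute.refl T)

theorem commute_one_sub (C : RieszContour T σ) : Commute T (1 - rieszProjection F T C) :=
  Commute.sub_right (Commute.one_right T) (C.commute_self F)

theorem commute_rieszProjection (C : RieszContour T σ) (D : RieszContour T τ) :
    Commute (rieszProjection F T C) (rieszProjection F T D) :=
  D.commute F (C.commute_self F).symm

theorem mul_eq_zero_of_disjoint (C : RieszContour T σ) (D : RieszContour T τ)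
    (h : Disjoint σ τ) : rieszProjection F T C * rieszProjection F T D = 0 := by
  refine eq_zero_of_invertibleOn (C.isIdempotentElem F) (D.isIdempotentElem F)
    (C.commute_rieszProjection F D) (C.commute_self F) (D.commute_self F) fun q => ?_
  by_cases hq : q ∈ σ
  · exact .inr (D.invertibleOn F (Set.disjoint_left.1 h hq))
  · exact .inl (C.invertibleOn F hq)

/-- An idempotent commuting with `T` dominates the Riesz projection for `σ` if `T` has no
spectrum in `σ` on its complement. -/
theorem mul_eq_self (C : RieszContour T σ) {G : V →L[ℍ[ℝ]ᵐᵒᵖ] V} (hG : IsIdempotentElem G)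
    (hT : Commute T G) (h : ∀ q ∈ σ, InvertibleOn (pencil T q) (1 - G)) :
    rieszProjection F T C * G = rieszProjection F T C := by
  have h1 : rieszProjection F T C * (1 - G) = 0 := by
    refine eq_zero_of_invertibleOn (C.isIdempotentElem F) hG.one_sub
      (Commute.sub_right (Commute.one_right _) (C.commute F hT.symm).symm) (C.commute_self F)
      (Commute.sub_right (Commute.one_right T) hT) fun q => ?_
    by_cases hq : q ∈ σ
    · exact .inr (h q hq)
    · exact .inl (C.invertibleOn F hq)
  rw [mul_sub_op, mul_one, sub_eq_zero] at h1
  exact h1.symm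

theorem range_le (C : RieszContour T σ) {G : V →L[ℍ[ℝ]ᵐᵒᵖ] V} {W : Submodule ℍ[ℝ]ᵐᵒᵖ V}
    (hW : ∀ v, v ∈ W ↔ G v = v) (hG : IsIdempotentElem G)
    (hT : Commute T G) (h : ∀ q ∈ σ, InvertibleOn (pencil T q) (1 - G)) :
    (rieszProjection F T C).range ≤ W := by
  have h1 := C.mul_eq_self F hG hT h
  rw [← (C.commute F hT.symm).eq] at h1
  rintro _ ⟨v, rfl⟩
  exact (hW _).2 (congrArg (fun A : V →L[ℍ[ℝ]ᵐᵒᵖ] V => A v) h1)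

end RieszContour

theorem disjoint_of_mem_spheresOf {s t : Set ℍ[ℝ]} (hs : s ∈ spheresOf σ) (ht : t ∈ spheresOf σ)
    (h : s ≠ t) : Disjoint s t := by
  obtain ⟨p, -, rfl⟩ := hs
  obtain ⟨q, -, rfl⟩ := ht
  rw [Set.disjoint_left]
  exact fun r h1 h2 => h ((sphere_eq_of_mem h1).symm.trans (sphere_eq_of_mem h2))

theorem orthogonalIdempotents_rieszProjection
    (D : (s : spheresOf σ) → RieszContour T (s : Set ℍ[ℝ])) :
    OrthogonalIdempotents fun s => rieszProjection F T (D s) where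
  idem s := (D s).isIdempotentElem F
  ortho s t h := (D s).mul_eq_zero_of_disjoint F (D t)
    (disjoint_of_mem_spheresOf s.2 t.2 fun h' => h (Subtype.ext h'))

/-- The Riesz projection is the sum of the Riesz projections of the spheres. -/
theorem rieszProjection_eq_sum (hax : AxiallySymmetric σ) (C : RieszContour T σ)
    [Fintype (spheresOf σ)] (D : (s : spheresOf σ) → RieszContour T (s : Set ℍ[ℝ])) :
    rieszProjection F T C = ∑ s, rieszProjection F T (D s) := by
  have ho := orthogonalIdempotents_rieszProjection F D
  set Q := ∑ s, rieszProjection F T (D s) with hQ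
  have hQi : IsIdempotentElem Q := ho.isIdempotentElem_sum
  have hQT : Commute T Q := Commute.sum_right _ _ _ fun s _ => (D s).commute_self F
  -- Domination of `P_σ` by `Q`: for `q` in `σ`, the pencil is invertible on the range of `1 -
  -- P_[q]`, hence on that of `1 - Q = (1 - Q)(1 - P_[q])`. Each summand of `Q` is in turn dominated
  -- by `P_σ`, which yields equality.
  have h1 : rieszProjection F T C * Q = rieszProjection F T C := by
    refine C.mul_eq_self F hQi hQT fun q hq => ?_
    let s : spheresOf σ := ⟨sphere q, q, hq, rfl⟩
    have h2 := ((D s).invertibleOn_one_sub F (self_mem_sphere q)).mul_left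
      (f := 1 - Q) (commute_pencil (Commute.sub_right (Commute.one_right T) hQT) q)
    have h3 : Q * rieszProjection F T (D s) = rieszProjection F T (D s) :=
      (((D s).commute F hQT.symm).eq.trans (ho.mul_sum_of_mem (Finset.mem_univ s)))
    have h4 : (1 - Q) * (1 - rieszProjection F T (D s)) = 1 - Q := by
      rw [mul_sub_op, mul_one, sub_mul_op, h3, one_mul, sub_self, sub_zero]
    rwa [h4] at h2
  rw [← h1, hQ, Finset.mul_sum]
  refine Finset.sum_congr rfl fun s _ => ?_
  rw [(C.commute_rieszProjection F (D s)).eq]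
  refine (D s).mul_eq_self F (C.isIdempotentElem F) (C.commute_self F) fun q hq => ?_
  obtain ⟨p, hp, hps⟩ := s.2
  exact C.invertibleOn_one_sub F (hax p hp (hps ▸ hq))

/-- The decomposition is the range of the Riesz projection plus its kernel, written as the range of
`1 - P`. On the first, the pencil fails to be invertible exactly on `[q]`; on the second it is
invertible there. -/
theorem isEigenvalueOfFiniteType_of_finiteDimensional {q : ℍ[ℝ]}
    (D : RieszContour T (sphere q))
    (h : FiniteDimensional ℍ[ℝ]ᵐᵒᵖ (rieszProjection F T D).range) :
    IsEigenvalueOfFiniteType T q := by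
  set P := rieszProjection F T D with hP
  have hi := D.isIdempotentElem F
  have hT := D.commute_self F
  have hT' := D.commute_one_sub F
  have hinv : ∀ {G : V →L[ℍ[ℝ]ᵐᵒᵖ] V}, IsIdempotentElem G → Commute T G →
      ∀ f ∈ G.range, T f ∈ G.range := by
    intro G hG hc f hf
    rw [hG.mem_range_iff_apply_eq] at hf ⊢
    have h1 : T (G f) = G (T f) := congrArg (fun A : V →L[ℍ[ℝ]ᵐᵒᵖ] V => A f) hc.eq
    rw [← h1, hf]
  have hcl : ∀ {G : V →L[ℍ[ℝ]ᵐᵒᵖ] V}, IsIdempotentElem G → IsClosed (G.range : Set V) := by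
    intro G hG
    have h1 : (G.range : Set V) = {v | G v = v} := by
      ext v
      exact hG.mem_range_iff_apply_eq
    rw [h1]
    exact isClosed_eq G.continuous continuous_id
  have hsp : q ∈ sSpectrum T := by
    have h1 : q ∈ D.U ∩ sSpectrum T := D.inter_U.symm ▸ self_mem_sphere q
    exact h1.2
  have hspec : ∀ {G : V →L[ℍ[ℝ]ᵐᵒᵖ] V} (hG : IsIdempotentElem G) (hc : Commute T G) (p : ℍ[ℝ]),
      p ∈ sSpectrum (T.restrict (hinv hG hc)) ↔ ¬InvertibleOn (pencil T p) G :=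
    fun hG hc p => not_congr (mem_sResolventSet_restrict_iff _
      (fun v => hG.mem_range_iff_apply_eq) hG (commute_pencil hc p))
  have heq : ∀ p, p ∈ sSpectrum (T.restrict (hinv hi hT)) ↔ p ∈ sphere q := fun p => by
    rw [hspec hi hT]
    refine ⟨fun hp => ?_, fun hp => D.not_invertibleOn F hp⟩
    by_contra h'
    exact hp (D.invertibleOn F h')
  refine ⟨hsp, P.range, (1 - P).range, hinv hi hT, hinv hi.one_sub hT', hcl hi,
    hcl hi.one_sub, ⟨?_, ?_⟩, h, ?_, Set.ext heq⟩
  · rw [Submodule.disjoint_def]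
    intro v h1 h2
    rw [hi.mem_range_iff_apply_eq] at h1
    rw [hi.one_sub.mem_range_iff_apply_eq] at h2
    change v - P v = v at h2
    rw [← hP] at h1
    rw [h1, sub_self] at h2
    exact h2.symm
  · rw [codisjoint_iff, eq_top_iff]
    intro v _
    refine Submodule.mem_sup.2 ⟨P v, ⟨v, rfl⟩, v - P v, ⟨v, rfl⟩, add_sub_cancel _ _⟩
  · rw [Set.disjoint_left]
    intro p h1 h2
    exact (hspec hi.one_sub hT' p).1 h2 (D.invertibleOn_one_sub F ((heq p).1 h1))

/-- The projection onto `V₁` along `V₂` dominates the Riesz projection, because `T` has no spectrum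
in `[q]` on `V₂`. The inclusion of the range in `V₁` is enough. -/
theorem finiteDimensional_of_isEigenvalueOfFiniteType {q : ℍ[ℝ]}
    (D : RieszContour T (sphere q)) (h : IsEigenvalueOfFiniteType T q) :
    FiniteDimensional ℍ[ℝ]ᵐᵒᵖ (rieszProjection F T D).range := by
  obtain ⟨-, V₁, V₂, h₁, h₂, hc₁, hc₂, hcompl, hfd, hdisj, hspec⟩ := h
  obtain ⟨G, hG, hT, hV₁, hV₂⟩ := exists_projection h₁ h₂ hc₁ hc₂ hcompl
  refine Submodule.finiteDimensional_of_le (S₂ := V₁) (D.range_le F hV₁ hG hT fun p hp => ?_)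
  have h1 : p ∈ sResolventSet (T.restrict h₂) := by
    by_contra h'
    exact Set.disjoint_left.1 hdisj (hspec ▸ hp) h'
  exact (mem_sResolventSet_restrict_iff h₂ hV₂ hG.one_sub
    (commute_pencil (Commute.sub_right (Commute.one_right T) hT) p)).1 h1

end FiniteType

end SpectralQuaternion

theorem mainTheorem7 {V : Type*} [NormedAddCommGroup V] [NormedSpace ℝ V] [Module ℍ[ℝ]ᵐᵒᵖ V]
    [IsScalarTower ℝ ℍ[ℝ]ᵐᵒᵖ V] [QInnerProductSpace V] [CompleteSpace V]
    {ι : Type*} (F : QHilbertBasis ι V) (T : V →L[ℍ[ℝ]ᵐᵒᵖ] V)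
    (σ : Set ℍ[ℝ]) (hσ : IsIsolatedPart T σ) (hax : AxiallySymmetric σ)
    (C : RieszContour T σ) :
    (FiniteDimensional ℍ[ℝ]ᵐᵒᵖ (rieszProjection F T C).range ↔
      (spheresOf σ).Finite ∧ ∀ q ∈ σ, IsEigenvalueOfFiniteType T q) ∧
    (FiniteDimensional ℍ[ℝ]ᵐᵒᵖ (rieszProjection F T C).range →
      (∀ s ∈ spheresOf σ, IsIsolatedPart T s ∧ Nonempty (RieszContour T s)) ∧
      ∀ D : (s : spheresOf σ) → RieszContour T (s : Set ℍ[ℝ]),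
        Module.rank ℍ[ℝ]ᵐᵒᵖ (rieszProjection F T C).range =
          ∑ᶠ s : spheresOf σ, Module.rank ℍ[ℝ]ᵐᵒᵖ (rieszProjection F T (D s)).range) := by
  have hiso : (spheresOf σ).Finite → ∀ s ∈ spheresOf σ,
      IsIsolatedPart T s ∧ Nonempty (RieszContour T s) := by
    intro hfin s hs
    have h1 := isIsolatedPart_sphere hσ hax hfin hs
    obtain ⟨q, -, rfl⟩ := hs
    exact ⟨h1, nonempty_rieszContour_sphere h1⟩
  refine ⟨⟨fun h => ?_, fun ⟨hfin, hev⟩ => ?_⟩, fun h => ?_⟩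
  · have hfin := finite_spheresOf F C h
    refine ⟨hfin, fun q hq => ?_⟩
    obtain ⟨D⟩ := (hiso hfin _ ⟨q, hq, rfl⟩).2
    refine isEigenvalueOfFiniteType_of_finiteDimensional F D ?_
    -- `P_[q]` is dominated by `P_σ`, since `[q]` lies in `σ` and the pencil is invertible on the
    -- range of `1 - P_σ` at all points of `σ`.
    exact Submodule.finiteDimensional_of_le (D.range_le F
      (fun v => (C.isIdempotentElem F).mem_range_iff_apply_eq) (C.isIdempotentElem F)
      (C.commute_self F) fun p hp => C.invertibleOn_one_sub F (hax q hq hp))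
  · have := hfin.fintype
    let D : (s : spheresOf σ) → RieszContour T (s : Set ℍ[ℝ]) := fun s => (hiso hfin s s.2).2.some
    rw [rieszProjection_eq_sum F hax C D]
    refine finiteDimensional_range_sum fun s => ?_
    obtain ⟨_, q, hq, rfl⟩ := s
    exact finiteDimensional_of_isEigenvalueOfFiniteType F _ (hev q hq)
  · have hfin := finite_spheresOf F C h
    refine ⟨hiso hfin, fun D => ?_⟩
    have := hfin.fintype
    -- The index type is finite, so the default value of `∑ᶠ` for infinite supports plays no role.
    rw [finsum_eq_sum_of_fintype, rieszProjection_eq_sum F hax C D,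
      rank_range_sum_of_orthogonalIdempotents (orthogonalIdempotents_rieszProjection F D)]
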